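/- Let $K$ be a commutative ring and let $\mathbf{Sym}=K\langle S_1,S_2,\dots\rangle$ be the algebra of noncommutative symmetric functions, the free associative algebra on $S_n$ ($n\ge 1$, $\deg S_n=n$, $S_0=1$), with $S^I=S_{i_1}\cdots S_{i_r}$ for a composition $I=(i_1,\dots,i_r)$, $\ell(I)=r$. Let $g(t)=\sum_{n\ge0}g_nt^n$ be the noncommutative Lagrange series, i.e. the unique solution of $g(t)=\sum_{n\ge0}S_n\,t^n g(t)^n$ with coefficients in $\mathbf{Sym}$ ($t$ commuting with everything), and put $g^I=g_{i_1}\cdots g_{i_r}$. Let $F(A)\mapsto F(-A)$ be the algebra automorphism of $\mathbf{Sym}$ with $S_n\mapsto(-1)^n\Lambda_n$, where $\sum_n(-t)^n\Lambda_n=\big(\sum_n t^nS_n\big)^{-1}$. Let $\langle\cdot,\cdot\rangle$ be the pairing of quasi-symmetric functions $QSym$ with $\mathbf{Sym}$ for which the monomial basis $(M_I)$ and $(S^I)$ are dual, write $J\le I$ if $J$ is coarser than $I$ (every descent, i.e. proper partial sum, of $J$ is one of $I$), and let $E_I=\sum_{J\le I}M_J$ be the essential basis of $QSym$. **Theorem.**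 For every $n\ge 0$ there are unique coefficients $a_I\in K$ such that $$g_n(-A)=\sum_{I\vDash n}(-1)^{\ell(I)}a_I\,g^I,$$ and for every composition $I=(i_1,\dots,i_r)$ of $n$, with $2I=(2i_1,\dots,2i_r)$ and $\bar I=(i_r,\dots,i_1)$, $$a_I=\sum_{J\le 2I}\langle M_J,g_{2n}\rangle=\langle E_{2I},g_{2n}\rangle .$$ Moreover the following four sets have the same cardinality, and $a_I$ is (the image in $K$ of) this number: 1. the nondecreasing parking functions of type $(2i_1+1,\dots,2i_r+1)$, i.e. the nondecreasing words $a_1\cdots a_m$ of positive integers with $a_i\le i$ whose sequence of nonzero letter multiplicities, in increasing order of the letters, is this composition; 2. the plane trees whose arities of internal nodes, read in prefix order, form the composition $(2i_1+1,\dots,2i_r+1)$; 3. the sylvester classes of words of evaluation $2\bar I$, i.e. of words with $2i_{r+1-k}$ occurrences of $k$ for $1\le k\le r$ and no other letter, modulo the congruence generated by $u\,ac\,v\,b\,w\equiv u\,ca\,v\,b\,w$ for letters $a\le b<c$ and words $u,v,w$; 4. the parking quasi-ribbons of shape $(2I)^\sim$. Here $L^\sim$, for a composition $L$ of $N$, is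 the conjugate composition, whose descents are the $d$ with $0<d<N$ such that $N-d$ is not a descent of $L$; a parking quasi-ribbon of shape $L$ is a filling of the ribbon diagram with row lengths given by $L$, weakly increasing along rows and strictly increasing down columns (that is, from the last entry of each row to the first entry of the next), whose entries form a parking function. -/

import Mathlib

namespace NCLagrange

noncomputable section

/-! ### Compositions -/

/-- `J ≤ I`: the compositions `J` coarser than `I`, that is, all partial sums (descents) of `J`
are partial sums of `I`. -/
def coarsenings {n : ℕ} (I : Composition n) : Finset (Composition n) :=
  Finset.univ.filter fun J => J.boundaries ⊆ I.boundaries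

/-- The composition `2I = (2i₁, …, 2iᵣ)` of `2n`. -/
def double {n : ℕ} (I : Composition n) : Composition (2 * n) where
  blocks := I.blocks.map fun i => 2 * i
  blocks_pos := by
    intro i hi
    obtain ⟨j, hj, rfl⟩ := List.mem_map.1 hi
    have := I.blocks_pos hj
    omega
  blocks_sum := by
    rw [List.sum_map_mul_left, List.map_id', I.blocks_sum]

/-- The conjugate composition `I^∼`: its descents are the `d` with `0 < d < n` such that `n - d`
is not a descent of `I`. Equivalently, its parts are the heights of the columns of the ribbon
diagram of `I`, read from right to left. -/
def conjugate {n : ℕ} (I : Composition n) : Composition n :=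
  CompositionAsSet.toComposition
    { boundaries := Finset.univ.filter fun d =>
        d = 0 ∨ d = Fin.last n ∨ d.rev ∉ I.boundaries
      zero_mem := by simp
      getLast_mem := by simp }

/-! ### Noncommutative symmetric functions -/

/-- The algebra `Sym` of noncommutative symmetric functions over `K`: the free associative algebra
on generators `S₁, S₂, …`. -/
abbrev NSym (K : Type*) [CommRing K] : Type _ := FreeAlgebra K ℕ+

section NSym

variable (K : Type*) [CommRing K]

/-- The complete functions `S_n`, with `S₀ = 1`. -/
def S : ℕ → NSym K
  | 0 => 1
  | n + 1 => FreeAlgebra.ι K n.succPNat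

/-- The multiplicative family `S^I = S_{i₁} ⋯ S_{iᵣ}`. -/
def SProd {n : ℕ} (I : Composition n) : NSym K := (I.blocks.map (S K)).prod

/-- The elementary functions `Λ_n`, defined by
`∑ (-t)ⁿ Λ_n = (∑ tⁿ S_n)⁻¹`. -/
def elem (n : ℕ) : NSym K :=
  (-1) ^ n * PowerSeries.coeff n (PowerSeries.invOfUnit (PowerSeries.mk (S K)) 1)

/-- The algebra automorphism `F(A) ↦ F(-A)`, determined by `S_n(A) ↦ (-1)ⁿ Λ_n(A)`. -/
def negAlphabet : NSym K →ₐ[K] NSym K :=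
  FreeAlgebra.lift K fun n : ℕ+ => (-1) ^ (n : ℕ) * elem K n

/-- The homogeneous components `g_n` of the Lagrange series, the solution of
`g(t) = ∑ S_k t^k g(t)^k`. The recursion compares the coefficients of `t^n`, using that
the coefficient of `t^(n-k)` of `g(t)^k`, `k ≥ 1`, involves only `g_j` with `j < n`. -/
def g (n : ℕ) : NSym K :=
  match n with
  | 0 => 1
  | n + 1 => ∑ k ∈ Finset.range (n + 1), S K (k + 1) *
      PowerSeries.coeff (n - k)
        ((PowerSeries.mk fun j => if _h : j < n + 1 then g j else 0) ^ (k + 1))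
termination_by n

/-- The multiplicative basis `g^I = g_{i₁} ⋯ g_{iᵣ}`. -/
def gProd {n : ℕ} (I : Composition n) : NSym K := (I.blocks.map (g K)).prod

theorem coeff_pow_congr {R : Type*} [Semiring R] {f h : PowerSeries R} {m : ℕ}
    (hfh : ∀ j ≤ m, PowerSeries.coeff j f = PowerSeries.coeff j h) (k : ℕ) :
    ∀ j ≤ m, PowerSeries.coeff j (f ^ k) = PowerSeries.coeff j (h ^ k) := by
  induction k with
  | zero => intro j _; simp
  | succ k ih =>
    intro j hj
    rw [pow_succ, pow_succ, PowerSeries.coeff_mul, PowerSeries.coeff_mul]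
    refine Finset.sum_congr rfl fun p hp => ?_
    have := Finset.HasAntidiagonal.mem_antidiagonal.1 hp
    rw [ih _ (by omega), hfh _ (by omega)]

/-- The functional equation `g(t) = ∑_{k ≥ 0} S_k t^k g(t)^k`, coefficient by coefficient. -/
theorem g_functional_equation (n : ℕ) :
    g K n = ∑ k ∈ Finset.range (n + 1),
      S K k * PowerSeries.coeff (n - k) (PowerSeries.mk (g K) ^ k) := by
  cases n with
  | zero => simp [g, S]
  | succ n =>
    rw [Finset.sum_range_succ', g]
    have h0 : S K 0 * PowerSeries.coeff (n + 1 - 0) (PowerSeries.mk (g K) ^ 0) = 0 := by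
      simp [PowerSeries.coeff_one]
    rw [h0, add_zero]
    refine Finset.sum_congr rfl fun k _ => ?_
    rw [Nat.add_sub_add_right]
    congr 1
    refine coeff_pow_congr (m := n) ?_ (k + 1) (n - k) (Nat.sub_le _ _)
    intro j hj
    simp only [PowerSeries.coeff_mk]
    rw [dif_pos (Nat.lt_succ_of_le hj)]

/-- The functional equation determines `g`. -/
theorem g_unique (f : ℕ → NSym K)
    (hf : ∀ n, f n = ∑ k ∈ Finset.range (n + 1),
      S K k * PowerSeries.coeff (n - k) (PowerSeries.mk f ^ k)) : f = g K := by
  funext n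
  induction n using Nat.strong_induction_on with
  | _ n ih =>
    rw [hf, g_functional_equation]
    refine Finset.sum_congr rfl fun k _ => ?_
    rcases Nat.eq_zero_or_pos k with rfl | hk
    · simp
    rcases Nat.eq_zero_or_pos n with rfl | hn
    · simp_all
    congr 1
    refine coeff_pow_congr (m := n - 1) ?_ k (n - k) (by omega)
    intro j hj
    simpa using ih j (by omega)

end NSym

/-! ### Quasi-symmetric functions and the duality -/

/-- The nonzero exponents of the monomial `x^d`, in increasing order of the variables. -/
def packedExponents (d : ℕ →₀ ℕ) : List ℕ := d.support.sort.map d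

section QSym

variable (K : Type*) [CommRing K]

/-- The quasi-symmetric functions in the variables `x₀ < x₁ < ⋯`: series of bounded degree in
which the coefficient of a monomial depends only on the sequence of its nonzero exponents. -/
def QSym : Submodule K (MvPowerSeries ℕ K) where
  carrier := {F | (∃ N : ℕ, ∀ d : ℕ →₀ ℕ, N < d.degree → MvPowerSeries.coeff d F = 0) ∧
    ∀ d e : ℕ →₀ ℕ, packedExponents d = packedExponents e →
      MvPowerSeries.coeff d F = MvPowerSeries.coeff e F}
  zero_mem' := by simp
  add_mem' := by
    rintro F G ⟨⟨N, hN⟩, hF⟩ ⟨⟨N', hN'⟩, hG⟩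
    refine ⟨⟨max N N', fun d hd => ?_⟩, fun d e hde => ?_⟩
    · rw [map_add, hN d (lt_of_le_of_lt (le_max_left _ _) hd),
        hN' d (lt_of_le_of_lt (le_max_right _ _) hd), add_zero]
    · rw [map_add, map_add, hF d e hde, hG d e hde]
  smul_mem' := by
    rintro c F ⟨⟨N, hN⟩, hF⟩
    refine ⟨⟨N, fun d hd => ?_⟩, fun d e hde => ?_⟩
    · rw [map_smul, hN d hd, smul_zero]
    · rw [map_smul, map_smul, hF d e hde]

theorem sum_packedExponents (d : ℕ →₀ ℕ) : (packedExponents d).sum = d.degree := by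
  rw [packedExponents, Finsupp.degree_apply]
  have h : (d.support.sort : Multiset ℕ) = d.support.val := Finset.sort_eq _ _
  rw [Finset.sum, ← h, Multiset.map_coe, Multiset.sum_coe]

/-- The monomial quasi-symmetric function `M_I = ∑_{j₁ < ⋯ < jᵣ} x_{j₁}^{i₁} ⋯ x_{jᵣ}^{iᵣ}`. -/
def M {n : ℕ} (I : Composition n) : QSym K :=
  ⟨fun d => if packedExponents d = I.blocks then 1 else 0, by
    refine ⟨⟨n, fun d hd => if_neg fun h => ?_⟩, fun d e hde => ?_⟩
    · rw [← sum_packedExponents, h, I.blocks_sum] at hd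
      exact lt_irrefl _ hd
    · change (if packedExponents d = I.blocks then (1 : K) else 0) =
        if packedExponents e = I.blocks then 1 else 0
      rw [hde]⟩

/-- The essential quasi-symmetric function `E_I = ∑_{J ≤ I} M_J`. -/
def E {n : ℕ} (I : Composition n) : QSym K := ∑ J ∈ coarsenings I, M K J

/-- The duality pairing `⟨F, P⟩` of `QSym` and `Sym`, for which the `M_I` and the `S^I` are dual
bases: `⟨F, S^I⟩` is the coefficient of `M_I` in `F`, that is, the coefficient of
`x₀^{i₁} x₁^{i₂} ⋯` in `F`. -/
def pairing : QSym K →ₗ[K] NSym K →ₗ[K] K :=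
  ((FreeAlgebra.basisFreeMonoid K ℕ+).constr K).toLinearMap ∘ₗ
    LinearMap.pi fun w : FreeMonoid ℕ+ =>
      MvPowerSeries.coeff (w.toList.map (fun i : ℕ+ => (i : ℕ))).toFinsupp ∘ₗ (QSym K).subtype

theorem packedExponents_toFinsupp (l : List ℕ) (hl : ∀ x ∈ l, x ≠ 0) :
    packedExponents l.toFinsupp = l := by
  have h1 : l.toFinsupp.support = Finset.range l.length := by
    ext i
    simp only [Finsupp.mem_support_iff, List.toFinsupp_apply, Finset.mem_range]
    constructor
    · intro h
      by_contra hi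
      exact h (List.getD_eq_default _ _ (not_lt.1 hi))
    · intro h
      rw [List.getD_eq_getElem _ _ h]
      exact hl _ (List.getElem_mem h)
  have h2 : (Finset.range l.length).sort = List.range l.length := by
    refine List.Perm.eq_of_pairwise' (r := (· ≤ ·)) (Finset.pairwise_sort _ _)
      (List.pairwise_le_range) ?_
    rw [← Multiset.coe_eq_coe, Finset.sort_eq]
    rfl
  rw [packedExponents, h1, h2]
  refine List.ext_getElem (by simp) fun i hi hi' => ?_
  simp [hi']

theorem SProd_eq_basis {n : ℕ} (J : Composition n) (w : FreeMonoid ℕ+)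
    (hw : w.toList.map (fun i : ℕ+ => (i : ℕ)) = J.blocks) :
    SProd K J = FreeAlgebra.basisFreeMonoid K ℕ+ w := by
  have hS : ∀ i : ℕ+, S K i = FreeAlgebra.ι K i := by
    intro i
    obtain ⟨m, rfl⟩ : ∃ m : ℕ, i = m.succPNat := ⟨i.natPred, (PNat.succPNat_natPred i).symm⟩
    rfl
  have hb : FreeAlgebra.basisFreeMonoid K ℕ+ w =
      FreeAlgebra.equivMonoidAlgebraFreeMonoid.symm (MonoidAlgebra.of K (FreeMonoid ℕ+) w) := rfl
  have hl : FreeAlgebra.equivMonoidAlgebraFreeMonoid.symm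
      (MonoidAlgebra.of K (FreeMonoid ℕ+) w) = FreeMonoid.lift (FreeAlgebra.ι K) w :=
    MonoidAlgebra.lift_of _ _
  rw [SProd, ← hw, List.map_map, hb, hl, FreeMonoid.lift_apply]
  congr 1
  exact List.map_congr_left fun i _ => hS i

/-- The bases `M_I` and `S^J` are dual to each other. -/
theorem pairing_M_SProd {n m : ℕ} (I : Composition n) (J : Composition m) :
    pairing K (M K I) (SProd K J) = if J.blocks = I.blocks then 1 else 0 := by
  obtain ⟨l, hl⟩ : ∃ l : List ℕ+, l.map (fun i : ℕ+ => (i : ℕ)) = J.blocks := by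
    refine ⟨J.blocks.map Nat.toPNat', ?_⟩
    rw [List.map_map]
    refine (List.map_congr_left fun i hi => ?_).trans (List.map_id _)
    have := J.blocks_pos hi
    simp [this]
  rw [SProd_eq_basis K J (FreeMonoid.ofList l) hl]
  have h : pairing K (M K I) (FreeAlgebra.basisFreeMonoid K ℕ+ (FreeMonoid.ofList l)) =
      if packedExponents (l.map (fun i : ℕ+ => (i : ℕ))).toFinsupp = I.blocks then 1 else 0 := by
    simp only [pairing, LinearMap.comp_apply, LinearEquiv.coe_coe, Module.Basis.constr_basis]
    rfl
  rw [h, packedExponents_toFinsupp _ (by simp), hl]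

end QSym

/-! ### Parking functions -/

/-- Parking functions: words over the positive integers whose nondecreasing rearrangement
`a₁ a₂ ⋯ a_n` satisfies `a_i ≤ i`. -/
def IsParking (w : List ℕ) : Prop :=
  (∀ x ∈ w, 1 ≤ x) ∧
    ∀ (i : ℕ) (hi : i < (w.insertionSort (· ≤ ·)).length), (w.insertionSort (· ≤ ·))[i] ≤ i + 1

/-- Nondecreasing parking functions. -/
def IsNDPF (w : List ℕ) : Prop := w.Pairwise (· ≤ ·) ∧ IsParking w

/-- The type (packed evaluation) of a word: the multiplicities of the letters that occur in it,
in increasing order of the letters. -/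
def packedEvaluation (w : List ℕ) : List ℕ := w.toFinset.sort.map fun x => w.count x

/-- The nondecreasing parking functions of type `c`. -/
def ndpfOfType (c : List ℕ) : Set (List ℕ) := {w | IsNDPF w ∧ packedEvaluation w = c}

/-- The parking quasi-ribbons of shape `I`, given by the list of their rows: fillings of the ribbon
diagram of `I` (whose rows have lengths `i₁, …, iᵣ`, the last cell of each row lying above the
first cell of the next one), weakly increasing along rows and strictly increasing down columns,
which form a parking function. -/
def parkingQuasiRibbons {n : ℕ} (I : Composition n) : Set (List (List ℕ)) :=
  {rows | rows.map List.length = I.blocks ∧ (∀ r ∈ rows, r.Pairwise (· ≤ ·)) ∧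
    rows.IsChain (fun r s => ∀ x ∈ r.getLast?, ∀ y ∈ s.head?, x < y) ∧ IsParking rows.flatten}

/-! ### Plane trees -/

/-- Plane (ordered, rooted) trees. -/
inductive PlaneTree : Type
  | node : List PlaneTree → PlaneTree

/-- The arities of all the nodes of a plane tree in prefix order. -/
def PlaneTree.arities : PlaneTree → List ℕ
  | .node ts => ts.length :: (ts.map PlaneTree.arities).flatten

/-- The plane trees whose arities of internal nodes, read in prefix order, form `c`. -/
def planeTreesOfType (c : List ℕ) : Set PlaneTree :=
  {T | T.arities.filter (fun k => k ≠ 0) = c}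

/-! ### Sylvester classes -/

/-- The elementary rewritings `u ac v b w → u ca v b w`, `a ≤ b < c`, that generate the
sylvester congruence. -/
inductive SylvesterStep : List ℕ → List ℕ → Prop
  | swap (u v w : List ℕ) (a b c : ℕ) (hab : a ≤ b) (hbc : b < c) :
      SylvesterStep (u ++ a :: c :: (v ++ b :: w)) (u ++ c :: a :: (v ++ b :: w))

/-- The words over the positive integers of evaluation `c`: the letter `i` occurs `c_i` times. -/
def wordsOfEvaluation (c : List ℕ) : Set (List ℕ) :=
  {w | (∀ x ∈ w, 1 ≤ x) ∧ ∀ i : ℕ, w.count (i + 1) = c.getD i 0}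

/-- The sylvester classes of words of evaluation `c`. (`Quot` takes the quotient by the
equivalence relation generated by the elementary rewritings.) -/
def sylvesterClasses (c : List ℕ) : Set (Quot SylvesterStep) :=
  Quot.mk SylvesterStep '' wordsOfEvaluation c

end

end NCLagrange

open NCLagrange

namespace NCLagrange

open PowerSeries Finset

/-! ### Composition of power series with noncommuting coefficients -/

/-! Write `σ(t) = ∑ S_n tⁿ`, and let `h` be the Lagrange series of the alphabet `-A`, so that `h = ∑
τ_k t^k h^k` with `τ = σ⁻¹`. All coefficients stay to the left of the series they multiply, so
substitutions can be composed without commutativity (`shiftedSum_shiftedSum`). Cancelling `σ`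
against `τ` gives `∑ S_k t^k h^(k+1) = 1`, and from this, for every `m`, `∑ [t^k](g^m) t^k h^(2k+m)
= 1` (`shiftedSum_lagrange_pow`). The case `m = 1`, multiplied by `h^p`, is the recursion `h^(p+1) =
h^p - ∑_{k ≥ 1} g_k t^k h^(p+2k+1)`, the exact analogue of `g^(p+1) = g^p + ∑_{k ≥ 1} S_k t^k
g^(p+k)`.

Both recursions have the shape of the decomposition of a plane forest according to whether its first
tree is a single leaf. They therefore expand `g_n` over the `S^I` and `g_n(-A)` over the `g^I`, with
forest counts of types `I` and `(2i + 1)_i` respectively, and with signs in the second case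
(`coeff_pow_eq_sum_forestCount`). Uniqueness follows from an endomorphism of `Sym` that sends each
`g^I` to `S^I`.

What remains is enumerative. Summing forest counts over the coarsenings of a composition increases
every part by one (`sum_coarsenings_forestCount`). Nondecreasing parking functions and plane forests
obey the forest recursion directly. Sylvester classes correspond to binary search trees, which are
counted by adding nodes in infix order and recording the length of the leftmost branch. Parking
quasi-ribbons are counted entry by entry, which gives the boundary word of the other count
transposed; lattice path counts are invariant under transposition (`pathCount_transposeWord`). -/

/-- The series `∑ aₖ tᵏ eₖ`. -/
noncomputable def shiftedSum {A : Type*} [Semiring A] (a : ℕ → A) (e : ℕ → PowerSeries A) :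
    PowerSeries A :=
  PowerSeries.mk fun n => ∑ x ∈ antidiagonal n, a x.1 * coeff x.2 (e x.1)

theorem sum_antidiagonal_assoc {A : Type*} [AddCommMonoid A] (F : ℕ → ℕ → ℕ → A) (n : ℕ) :
    ∑ x ∈ antidiagonal n, ∑ y ∈ antidiagonal x.1, F y.1 y.2 x.2 =
      ∑ x ∈ antidiagonal n, ∑ y ∈ antidiagonal x.2, F x.1 y.1 y.2 := by
  simp only [sum_sigma']
  refine sum_nbij' (fun p => ⟨(p.2.1, p.2.2 + p.1.2), (p.2.2, p.1.2)⟩)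
    (fun p => ⟨(p.1.1 + p.2.1, p.2.2), (p.1.1, p.2.1)⟩) ?_ ?_ ?_ ?_ fun _ _ => rfl <;>
  · rintro ⟨⟨a, b⟩, ⟨c, d⟩⟩ h
    simp only [mem_sigma, HasAntidiagonal.mem_antidiagonal] at h ⊢
    obtain ⟨h1, rfl⟩ := h
    first | (simp; done) | omega | (simp; omega)

section ShiftedSum

variable {A : Type*} [Semiring A]

theorem coeff_shiftedSum (a : ℕ → A) (e : ℕ → PowerSeries A) (n : ℕ) :
    coeff n (shiftedSum a e) = ∑ x ∈ antidiagonal n, a x.1 * coeff x.2 (e x.1) :=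
  coeff_mk _ _

theorem coeff_shiftedSum_congr (a : ℕ → A) {e e' : ℕ → PowerSeries A} {n : ℕ}
    (h : ∀ i l, i + l = n → coeff l (e i) = coeff l (e' i)) :
    coeff n (shiftedSum a e) = coeff n (shiftedSum a e') := by
  rw [coeff_shiftedSum, coeff_shiftedSum]
  refine sum_congr rfl fun x hx => ?_
  rw [h _ _ (HasAntidiagonal.mem_antidiagonal.1 hx)]

theorem coeff_shiftedSum_eq_add (a : ℕ → A) (e : ℕ → PowerSeries A) (n : ℕ) :
    coeff n (shiftedSum a e) = a 0 * coeff n (e 0) +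
      ∑ k ∈ range n, a (k + 1) * coeff (n - 1 - k) (e (k + 1)) := by
  rw [coeff_shiftedSum,
    Nat.sum_antidiagonal_eq_sum_range_succ (fun i j => a i * coeff j (e i)),
    sum_range_succ', add_comm]
  congr 1
  refine sum_congr rfl fun k _ => ?_
  rw [Nat.sub_sub, Nat.add_comm 1 k]

theorem shiftedSum_mul (a : ℕ → A) (e : ℕ → PowerSeries A) (f : PowerSeries A) :
    shiftedSum a e * f = shiftedSum a fun k => e k * f := by
  ext n
  simp only [coeff_mul, coeff_shiftedSum, sum_mul, mul_sum, mul_assoc]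
  exact sum_antidiagonal_assoc (fun i j k => a i * (coeff j (e i) * coeff k f)) n

/-- Substitution is associative because every coefficient is multiplied on the left: both sides are
the sum of `a_i [t^j]b_i t^(i+j) e_(i+j)` over `i` and `j`. -/
theorem shiftedSum_shiftedSum (a : ℕ → A) (b e : ℕ → PowerSeries A) :
    shiftedSum (fun n => coeff n (shiftedSum a b)) e =
      shiftedSum a fun i => shiftedSum (fun j => coeff j (b i)) fun j => e (i + j) := by
  ext n
  simp only [coeff_shiftedSum, sum_mul, mul_sum, mul_assoc]
  refine Eq.trans ?_ (sum_antidiagonal_assoc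
    (fun i j k => a i * (coeff j (b i) * coeff k (e (i + j)))) n)
  refine sum_congr rfl fun x _ => sum_congr rfl fun y hy => ?_
  rw [HasAntidiagonal.mem_antidiagonal.1 hy]

theorem shiftedSum_one (e : ℕ → PowerSeries A) :
    shiftedSum (fun n => coeff n (1 : PowerSeries A)) e = e 0 := by
  ext n
  rw [coeff_shiftedSum_eq_add]
  simp [coeff_one]

theorem shiftedSum_const (a : ℕ → A) (f : PowerSeries A) :
    shiftedSum a (fun _ => f) = PowerSeries.mk a * f := by
  ext n
  simp [coeff_shiftedSum, coeff_mul]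

theorem map_shiftedSum {B : Type*} [Semiring B] (φ : A →+* B) (a : ℕ → A)
    (e : ℕ → PowerSeries A) :
    PowerSeries.map φ (shiftedSum a e) = shiftedSum (fun k => φ (a k))
      fun k => PowerSeries.map φ (e k) := by
  ext n
  simp [coeff_shiftedSum]

end ShiftedSum

theorem lagrange_eq (K : Type*) [CommRing K] :
    PowerSeries.mk (g K) = shiftedSum (S K) fun k => PowerSeries.mk (g K) ^ k := by
  ext n
  rw [coeff_mk, g_functional_equation, coeff_shiftedSum, Nat.sum_antidiagonal_eq_sum_range_succ
    (fun i j => S K i * coeff j (PowerSeries.mk (g K) ^ i))]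

/-! ### The Lagrange series of the alphabet `-A` -/

section NegAlphabet

variable (K : Type*) [CommRing K]

/-- The Lagrange series of the alphabet `-A`. -/
noncomputable def negLagrange : PowerSeries (NSym K) :=
  PowerSeries.mk fun n => negAlphabet K (g K n)

theorem mk_S_mul_invOfUnit :
    PowerSeries.mk (S K) * invOfUnit (PowerSeries.mk (S K)) 1 = 1 :=
  mul_invOfUnit _ _ (by simp [S])

theorem negAlphabet_S (n : ℕ) :
    negAlphabet K (S K n) = coeff n (invOfUnit (PowerSeries.mk (S K)) 1) := by
  cases n with
  | zero => simp [S]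
  | succ n =>
    have h : ((n.succPNat : ℕ+) : ℕ) = n + 1 := rfl
    rw [S, negAlphabet, FreeAlgebra.lift_ι_apply, elem, ← mul_assoc, h, ← pow_add,
      Even.neg_one_pow ⟨_, rfl⟩, one_mul]

theorem negLagrange_eq : negLagrange K =
    shiftedSum (fun k => coeff k (invOfUnit (PowerSeries.mk (S K)) 1))
      fun k => negLagrange K ^ k := by
  have h : PowerSeries.map (negAlphabet K : NSym K →+* NSym K) (PowerSeries.mk (g K)) =
      negLagrange K := by
    ext n
    simp [negLagrange]
  rw [← h]
  conv_lhs => rw [lagrange_eq, map_shiftedSum]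
  congr 1
  · funext k
    exact negAlphabet_S K k
  · funext k
    rw [map_pow]

theorem negLagrange_pow_succ (m : ℕ) : negLagrange K ^ (m + 1) =
    shiftedSum (fun k => coeff k (invOfUnit (PowerSeries.mk (S K)) 1))
      fun k => negLagrange K ^ (k + m) := by
  conv_lhs => rw [pow_succ', negLagrange_eq, shiftedSum_mul]
  rw [← negLagrange_eq]
  simp only [pow_add]

theorem lagrange_pow_succ (m : ℕ) : PowerSeries.mk (g K) ^ (m + 1) =
    shiftedSum (S K) fun k => PowerSeries.mk (g K) ^ (k + m) := by
  conv_lhs => rw [pow_succ', lagrange_eq, shiftedSum_mul]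
  rw [← lagrange_eq]
  simp only [pow_add]

/-- Expanding `h^(k+1) = ∑ τ_j t^j h^(k+j)` turns the left side into `∑ [t^n](σ τ) t^n h^n`, and `σ
τ = 1`. -/
theorem shiftedSum_S_negLagrange :
    shiftedSum (S K) (fun k => negLagrange K ^ (k + 1)) = 1 := by
  have h : (fun k => negLagrange K ^ (k + 1)) = fun k =>
      shiftedSum (fun j => coeff j (invOfUnit (PowerSeries.mk (S K)) 1))
        fun j => negLagrange K ^ (k + j) := by
    funext k
    rw [negLagrange_pow_succ]
    simp only [add_comm]
  rw [h, ← shiftedSum_shiftedSum (S K) (fun _ => invOfUnit (PowerSeries.mk (S K)) 1)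
    (fun k => negLagrange K ^ k), shiftedSum_const, mk_S_mul_invOfUnit, shiftedSum_one, pow_zero]

theorem coeff_mul_congr_left {A : Type*} [Semiring A] {f f' : PowerSeries A} {n : ℕ}
    (h : ∀ j ≤ n, coeff j f = coeff j f') (e : PowerSeries A) :
    coeff n (f * e) = coeff n (f' * e) := by
  rw [coeff_mul, coeff_mul]
  refine sum_congr rfl fun x hx => ?_
  rw [h _ (by have := HasAntidiagonal.mem_antidiagonal.1 hx; omega)]

/-- Let `Y m` be the left side. The equation for `g^(m+1)` gives `Y (m+1) = ∑ S_i t^i Y (i+m)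
h^(i+1)`. If all `Y` on the right are `1`, this is the preceding identity. The term `i = 0` involves
`Y m` in the same degree and the others only lower degrees, so an induction on the degree, then on
`m`, closes. -/
theorem shiftedSum_lagrange_pow (m : ℕ) :
    shiftedSum (fun k => coeff k (PowerSeries.mk (g K) ^ m))
      (fun k => negLagrange K ^ (2 * k + m)) = 1 := by
  set Y : ℕ → PowerSeries (NSym K) := fun m =>
    shiftedSum (fun k => coeff k (PowerSeries.mk (g K) ^ m))
      (fun k => negLagrange K ^ (2 * k + m)) with hY
  have hrec : ∀ m, Y (m + 1) =
      shiftedSum (S K) fun i => Y (i + m) * negLagrange K ^ (i + 1) := by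
    intro m
    simp only [hY, lagrange_pow_succ, shiftedSum_mul]
    rw [shiftedSum_shiftedSum]
    congr 1
    funext i
    congr 1
    funext j
    rw [← pow_add]
    congr 1
    ring
  have key : ∀ n m, coeff n (Y m) = coeff n (1 : PowerSeries (NSym K)) := by
    intro n
    induction n using Nat.strong_induction_on with
    | _ n ih =>
      intro m
      induction m with
      | zero =>
        simp only [hY, pow_zero, shiftedSum_one, mul_zero, add_zero]
      | succ m ihm =>
        rw [hrec, ← shiftedSum_S_negLagrange K]
        refine coeff_shiftedSum_congr _ fun i l hil => ?_
        have h : ∀ j ≤ l, coeff j (Y (i + m)) = coeff j (1 : PowerSeries (NSym K)) := by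
          intro j hj
          rcases Nat.eq_zero_or_pos i with rfl | hi
          · rcases eq_or_lt_of_le hj with rfl | hj
            · have : j = n := by omega
              subst this
              simpa using ihm
            · exact ih j (by omega) _
          · exact ih j (by omega) _
        rw [coeff_mul_congr_left h, one_mul]
  ext n
  exact key n m

/-- Isolating the term `k = 0` expresses `h^(p+1)` through `h^p` and coefficients of lower degree;
this is the recursion that produces the expansion over the `g^I`. -/
theorem shiftedSum_g_negLagrange (p : ℕ) :
    shiftedSum (g K) (fun k => negLagrange K ^ (2 * k + 1 + p)) = negLagrange K ^ p := by
  have h := congrArg (· * negLagrange K ^ p) (shiftedSum_lagrange_pow K 1)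
  simpa only [pow_one, coeff_mk, shiftedSum_mul, ← pow_add, one_mul] using h

end NegAlphabet

/-! ### Expansion over compositions -/

/-- The number of plane forests with `p` trees whose arities of internal nodes, read in prefix
order, form `c` (provided that all parts of `c` are positive). -/
def forestCount : ℕ → List ℕ → ℕ
  | _, [] => 1
  | p, c :: cs => ∑ q ∈ range p, forestCount (q + c) cs

/-- The first tree of a forest is either a leaf, which is removed, or has a root of arity `c`, which
is replaced by its `c` children. -/
theorem forestCount_succ_cons (p c : ℕ) (cs : List ℕ) :
    forestCount (p + 1) (c :: cs) = forestCount p (c :: cs) + forestCount (p + c) cs := by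
  simp only [forestCount, sum_range_succ]

theorem forestCount_zero_cons (c : ℕ) (cs : List ℕ) : forestCount 0 (c :: cs) = 0 := by
  simp [forestCount]

theorem sum_composition_zero {A : Type*} [AddCommMonoid A] (φ : List ℕ → A) :
    ∑ I : Composition 0, φ I.blocks = φ [] := by
  rw [sum_congr rfl fun I _ => congrArg φ (I.blocks_eq_nil.2 rfl), sum_const, card_univ,
    composition_card, pow_zero, one_smul]

theorem sum_composition_succ {A : Type*} [AddCommMonoid A] (φ : List ℕ → A) (n : ℕ) :
    ∑ I : Composition (n + 1), φ I.blocks =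
      ∑ k ∈ range (n + 1), ∑ I : Composition (n - k), φ ((k + 1) :: I.blocks) := by
  rw [sum_sigma']
  symm
  refine sum_bij (fun x hx => ⟨(x.1 + 1) :: x.2.blocks, ?_, ?_⟩) ?_ ?_ ?_ ?_
  · intro i hi
    rcases List.mem_cons.1 hi with rfl | hi
    · omega
    · exact x.2.blocks_pos hi
  · have := mem_range.1 (mem_sigma.1 hx).1
    simp only [List.sum_cons, x.2.blocks_sum]
    omega
  · intro x hx
    exact mem_univ _
  · rintro ⟨k, I⟩ _ ⟨l, J⟩ _ h
    have h := congrArg Composition.blocks h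
    simp only [List.cons.injEq, Nat.add_right_cancel_iff] at h
    obtain ⟨rfl, h⟩ := h
    rw [Composition.ext h]
  · rintro I -
    obtain ⟨k, l, h⟩ : ∃ k l, I.blocks = k :: l := by
      cases h : I.blocks with
      | nil => have := I.blocks_sum; simp [h] at this
      | cons k l => exact ⟨k, l, rfl⟩
    have hs := I.blocks_sum
    have hp : 0 < k := I.blocks_pos (by simp [h])
    rw [h, List.sum_cons] at hs
    refine ⟨⟨k - 1, ⟨l, fun {i} hi => I.blocks_pos (by simp [h, hi]), by omega⟩⟩, ?_, ?_⟩
    · simp only [mem_sigma, mem_range, mem_univ, and_true]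
      omega
    · refine Composition.ext ?_
      simp only [h]
      rw [Nat.sub_add_cancel hp]
  · intro x _
    rfl

/-- The hypothesis is the forest recursion with weights: `p` counts the pending trees, and
extracting `r (k+1)` on the left replaces one tree by `c (k+1)` new ones. The induction is on the
degree, then on `p`; splitting off the first block of a composition matches `forestCount_succ_cons`.
-/
theorem coeff_pow_eq_sum_forestCount {A : Type*} [Ring A] (f : PowerSeries A) (r : ℕ → A)
    (c : ℕ → ℕ)
    (hf : ∀ p n, coeff n (f ^ (p + 1)) = coeff n (f ^ p) +
      ∑ k ∈ range n, r (k + 1) * coeff (n - 1 - k) (f ^ (p + c (k + 1)))) (n p : ℕ) :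
    coeff n (f ^ p) = ∑ I : Composition n,
      forestCount p (I.blocks.map c) • (I.blocks.map r).prod := by
  induction n using Nat.strong_induction_on generalizing p with
  | _ n ih =>
    cases n with
    | zero =>
      rw [sum_composition_zero fun l => forestCount p (l.map c) • (l.map r).prod]
      induction p with
      | zero => simp [forestCount]
      | succ p ihp => rw [hf, ihp]; simp [forestCount]
    | succ n =>
      rw [sum_composition_succ fun l => forestCount p (l.map c) • (l.map r).prod]
      induction p with
      | zero => simp [forestCount, coeff_one]
      | succ p ihp =>
        rw [hf, ihp, ← sum_add_distrib]
        refine sum_congr rfl fun k hk => ?_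
        rw [Nat.add_sub_cancel, ih (n - k) (by omega), mul_sum, ← sum_add_distrib]
        refine sum_congr rfl fun I _ => ?_
        simp only [List.map_cons, List.prod_cons, forestCount_succ_cons, add_smul, mul_smul_comm]

theorem g_eq_sum (K : Type*) [CommRing K] (n : ℕ) :
    g K n = ∑ I : Composition n, (forestCount 1 I.blocks : K) • SProd K I := by
  have h := coeff_pow_eq_sum_forestCount (PowerSeries.mk (g K)) (S K) id (fun p n => by
    rw [lagrange_pow_succ, coeff_shiftedSum_eq_add]
    simp [S, add_comm]) n 1
  rw [pow_one, coeff_mk] at h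
  simpa only [List.map_id, ← Nat.cast_smul_eq_nsmul K, SProd] using h

theorem prod_map_neg {A : Type*} [Ring A] (r : ℕ → A) (l : List ℕ) :
    (l.map fun k => -r k).prod = (-1) ^ l.length * (l.map r).prod := by
  induction l with
  | nil => simp
  | cons a l ih =>
    have := (Commute.neg_one_left (r a)).pow_left l.length
    rw [List.map_cons, List.prod_cons, ih, List.map_cons, List.prod_cons, List.length_cons,
      pow_succ', neg_mul, ← mul_assoc, ← this.eq]
    simp [mul_assoc]

theorem negAlphabet_g_eq_sum (K : Type*) [CommRing K] (n : ℕ) :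
    negAlphabet K (g K n) = ∑ I : Composition n,
      ((-1) ^ I.length * (forestCount 1 (I.blocks.map fun i => 2 * i + 1) : K)) • gProd K I := by
  have h := coeff_pow_eq_sum_forestCount (negLagrange K) (fun k => -g K k)
    (fun i => 2 * i + 1) (fun p n => by
      have h0 : g K 0 = 1 := by simp [g]
      conv_rhs => rw [← shiftedSum_g_negLagrange K p]
      rw [coeff_shiftedSum_eq_add, h0]
      simp only [neg_mul, sum_neg_distrib, one_mul]
      rw [show 2 * 0 + 1 + p = p + 1 by ring]
      simp only [add_comm p]
      abel) n 1
  rw [pow_one, negLagrange, coeff_mk] at h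
  rw [h]
  refine sum_congr rfl fun I _ => ?_
  rw [prod_map_neg, gProd, Composition.blocks_length, mul_smul, Nat.cast_smul_eq_nsmul,
    ← mul_smul_comm]
  rcases Nat.even_or_odd I.length with hI | hI <;> simp [hI.neg_one_pow]

/-! ### Linear independence of the products `g^I` -/

section Independence

variable (K : Type*) [CommRing K]

/-- The images of the generators `S_n` under the inverse of the substitution `S_n ↦ g_n`. -/
noncomputable def invLagrange (n : ℕ) : NSym K :=
  S K n - ∑ k : Fin n, invLagrange k * coeff (n - k) (PowerSeries.mk (S K) ^ (k : ℕ))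

theorem shiftedSum_invLagrange :
    PowerSeries.mk (S K) = shiftedSum (invLagrange K) fun k => PowerSeries.mk (S K) ^ k := by
  ext n
  rw [coeff_mk, coeff_shiftedSum, Nat.sum_antidiagonal_eq_sum_range_succ
    (fun i j => invLagrange K i * coeff j (PowerSeries.mk (S K) ^ i)), sum_range_succ,
    ← Fin.sum_univ_eq_sum_range
      (fun i => invLagrange K i * coeff (n - i) (PowerSeries.mk (S K) ^ i))]
  conv_rhs => enter [2]; rw [invLagrange]
  simp [S]

theorem invLagrange_zero : invLagrange K 0 = 1 := by
  rw [invLagrange]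
  simp [S]

/-- The algebra endomorphism with `S_n ↦ invLagrange n`. -/
noncomputable def invLagrangeHom : NSym K →ₐ[K] NSym K :=
  FreeAlgebra.lift K fun n : ℕ+ => invLagrange K n

theorem invLagrangeHom_S (n : ℕ) : invLagrangeHom K (S K n) = invLagrange K n := by
  cases n with
  | zero => simp [S, invLagrange_zero]
  | succ n =>
    rw [S, invLagrangeHom, FreeAlgebra.lift_ι_apply]
    rfl

/-- The factor `t^i` makes the degree `n` part of the right side depend only on lower degrees of `f`
when `i > 0`, and `f ^ 0` does not depend on `f`. -/
theorem eq_of_shiftedSum_pow {A : Type*} [Semiring A] {a : ℕ → A} {f f' : PowerSeries A}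
    (hf : f = shiftedSum a fun k => f ^ k) (hf' : f' = shiftedSum a fun k => f' ^ k) :
    f = f' := by
  ext n
  induction n using Nat.strong_induction_on with
  | _ n ih =>
    rw [hf, hf']
    refine coeff_shiftedSum_congr _ fun i l hil => ?_
    rcases Nat.eq_zero_or_pos i with rfl | hi
    · simp
    · exact coeff_pow_congr (m := l) (fun j hj => ih j (by omega)) i l le_rfl

/-- The image of `g(t)` and the series `σ(t)` solve the same functional equation, with coefficients
`invLagrange k`, and its solution is unique. -/
theorem invLagrangeHom_g (n : ℕ) : invLagrangeHom K (g K n) = S K n := by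
  have h : PowerSeries.map (invLagrangeHom K : NSym K →+* NSym K) (PowerSeries.mk (g K)) =
      PowerSeries.mk (S K) := by
    refine eq_of_shiftedSum_pow (a := invLagrange K) ?_ (shiftedSum_invLagrange K)
    conv_lhs => rw [lagrange_eq, map_shiftedSum]
    congr 1
    · funext k
      exact invLagrangeHom_S K k
    · funext k
      rw [map_pow]
  simpa using congrArg (coeff n) h

theorem invLagrangeHom_gProd {n : ℕ} (I : Composition n) :
    invLagrangeHom K (gProd K I) = SProd K I := by
  rw [gProd, map_list_prod, List.map_map, SProd]
  congr 2
  funext k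
  exact invLagrangeHom_g K k

theorem pairing_M_sum_SProd {n : ℕ} (b : Composition n → K) (I : Composition n) :
    pairing K (M K I) (∑ J : Composition n, b J • SProd K J) = b I := by
  rw [map_sum, sum_eq_single I]
  · simp [pairing_M_SProd]
  · intro J _ hJ
    rw [map_smul, pairing_M_SProd, if_neg fun h => hJ (Composition.ext h), smul_zero]
  · simp

theorem gProd_coeff_unique {n : ℕ} {b b' : Composition n → K}
    (h : ∑ I : Composition n, b I • gProd K I = ∑ I : Composition n, b' I • gProd K I) :
    b = b' := by
  funext I
  have h := congrArg (fun x => pairing K (M K I) (invLagrangeHom K x)) h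
  simpa only [map_sum (invLagrangeHom K), map_smul (invLagrangeHom K), invLagrangeHom_gProd,
    pairing_M_sum_SProd] using h

theorem pairing_M_g {n : ℕ} (I : Composition n) :
    pairing K (M K I) (g K n) = (forestCount 1 I.blocks : K) := by
  rw [g_eq_sum, pairing_M_sum_SProd]

end Independence


/-! ### Counting lattice paths under a boundary word -/

/-- The value at `p` of the function obtained from the constant function `1` by applying, from
right to left, the operators given by the letters of a word: `false` is the shift
`f ↦ (p ↦ f (p + 1))`, and `true` the summation `f ↦ (p ↦ ∑_{q ≤ p} f q)`. -/
def pathCount : List Bool → ℕ → ℕ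
  | [], _ => 1
  | false :: w, p => pathCount w (p + 1)
  | true :: w, p => ∑ q ∈ range (p + 1), pathCount w q

theorem pathCount_true_zero (w : List Bool) : pathCount (true :: w) 0 = pathCount w 0 := by
  simp [pathCount]

theorem pathCount_replicate_false_append (l : ℕ) (w : List Bool) (p : ℕ) :
    pathCount (List.replicate l false ++ w) p = pathCount w (p + l) := by
  induction l generalizing p with
  | zero => rfl
  | succ l ih =>
    rw [List.replicate_succ, List.cons_append, pathCount, ih]
    congr 1
    omega

theorem pathCount_append_false (w : List Bool) (p : ℕ) :
    pathCount (w ++ [false]) p = pathCount w p := by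
  induction w generalizing p with
  | nil => rfl
  | cons b w ih => cases b <;> simp [pathCount, ih]

/-- For empty `u`, the two sums over `v` differ only by the term at `0`, a constant. The operators
of `u` are linear and send the constant `1` to `pathCount u`. Geometrically, turning one corner of
the boundary adds the paths through that corner. -/
theorem pathCount_swap (u v : List Bool) (p : ℕ) :
    pathCount (u ++ false :: true :: v) p =
      pathCount (u ++ true :: false :: v) p + pathCount u p * pathCount v 0 := by
  induction u generalizing p with
  | nil => simp [pathCount, sum_range_succ']
  | cons b u ih => cases b <;> simp [pathCount, ih, sum_add_distrib, sum_mul]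

/-- The word of the transposed boundary. -/
def transposeWord (w : List Bool) : List Bool := (w.map not).reverse

theorem exists_replicate_false_append (w : List Bool) :
    ∃ k, w = List.replicate k false ∨ ∃ v, w = List.replicate k false ++ true :: v := by
  induction w with
  | nil => exact ⟨0, Or.inl rfl⟩
  | cons b w ih =>
    cases b with
    | true => exact ⟨0, Or.inr ⟨w, rfl⟩⟩
    | false =>
      obtain ⟨k, rfl | ⟨v, rfl⟩⟩ := ih
      · exact ⟨k + 1, Or.inl rfl⟩
      · exact ⟨k + 1, Or.inr ⟨v, rfl⟩⟩

/-- Transposition fixes the patterns `false true` and `true false` and exchanges the words on either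
side of them, so the corner relation `pathCount_swap` is compatible with it. This relation moves the
first `true` to the front. There it acts trivially at `0`, and its transpose, a final `false`, acts
trivially on the constant `1`. -/
theorem pathCount_transposeWord (w : List Bool) :
    pathCount (transposeWord w) 0 = pathCount w 0 := by
  induction hn : w.length using Nat.strong_induction_on generalizing w with
  | _ n ih =>
    have key : ∀ k v, (List.replicate k false ++ true :: v).length = n →
        pathCount (transposeWord (List.replicate k false ++ true :: v)) 0 =
          pathCount (List.replicate k false ++ true :: v) 0 := by
      intro k
      induction k with
      | zero =>
        intro v hv
        simp only [List.replicate_zero, List.nil_append, List.length_cons] at hv ⊢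
        rw [pathCount_true_zero, ← ih v.length (by omega) v rfl]
        simp [transposeWord, pathCount_append_false]
      | succ k ihk =>
        intro v hv
        -- The word with the corner swapped has the same length but one `false` fewer in front of
        -- its first `true`; `h2` and `h3` treat the two shorter factors of the correction term.
        have h1 := ihk (false :: v) (by simp at hv ⊢; omega)
        have h2 := ih v.length (by simp at hv; omega) v rfl
        have h3 := ih k (by simp at hv; omega) (List.replicate k false) (by simp)
        rw [List.replicate_succ', List.append_assoc, List.singleton_append, pathCount_swap,
          ← h1, ← h2, ← h3]
        simp only [transposeWord, List.map_append, List.map_cons, List.reverse_append,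
          List.reverse_cons, Bool.not_true, Bool.not_false, List.append_assoc,
          List.cons_append, List.nil_append]
        rw [pathCount_swap, mul_comm]
    obtain ⟨k, rfl | ⟨v, rfl⟩⟩ := exists_replicate_false_append w
    · have h1 : ∀ k p, pathCount (List.replicate k false) p = 1 := by
        intro k p
        rw [← List.append_nil (List.replicate k false), pathCount_replicate_false_append]
        rfl
      have h2 : ∀ k, pathCount (List.replicate k true) 0 = 1 := by
        intro k
        induction k with
        | zero => rfl
        | succ k ih => rw [List.replicate_succ, pathCount_true_zero, ih]
      simp [transposeWord, h1, h2]
    · exact key k v hn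

/-- Both counts sum over `q ≤ p`; the extra unit in each part is absorbed by the offset of one
between the two parameters. -/
theorem forestCount_succ_map_succ (c : List ℕ) (p : ℕ) :
    forestCount (p + 1) (c.map (· + 1)) =
      pathCount (c.flatMap fun l => true :: List.replicate l false) p := by
  induction c generalizing p with
  | nil => rfl
  | cons l c ih =>
    rw [List.map_cons, forestCount, List.flatMap_cons, List.cons_append, pathCount]
    refine sum_congr rfl fun q _ => ?_
    rw [pathCount_replicate_false_append, ← ih]
    congr 1

/-! ### Indicator words of compositions -/

/-- The indicator word of the partial sums of a list of blocks. -/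
def indicator (l : List ℕ) : List Bool :=
  l.flatMap fun k => true :: List.replicate (k - 1) false

theorem length_indicator {l : List ℕ} (hl : ∀ k ∈ l, 0 < k) : (indicator l).length = l.sum := by
  induction l with
  | nil => rfl
  | cons k l ih =>
    have := hl k (by simp)
    have := ih fun k hk => hl k (by simp [hk])
    simp only [indicator, List.flatMap_cons, List.length_append, List.length_cons,
      List.length_replicate, List.sum_cons] at *
    omega

theorem indicator_getElem?_eq_true {l : List ℕ} (hl : ∀ k ∈ l, 0 < k) (j : ℕ) :
    (indicator l)[j]? = some true ↔ ∃ i < l.length, (l.take i).sum = j := by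
  induction l generalizing j with
  | nil => simp [indicator]
  | cons k l ih =>
    have hk := hl k (by simp)
    have ih := ih (fun k hk => hl k (by simp [hk])) (j - k)
    have e : indicator (k :: l) = (true :: List.replicate (k - 1) false) ++ indicator l := rfl
    rcases lt_or_ge j k with h | h
    · rw [e, List.getElem?_append_left (by simp; omega)]
      cases j with
      | zero => exact ⟨fun _ => ⟨0, by simp⟩, fun _ => by simp⟩
      | succ j =>
        constructor
        · simp [List.getElem?_replicate]
        · rintro ⟨i, hi, hs⟩
          cases i with
          | zero => simp at hs
          | succ i => simp at hs; omega
    · have hlen : (true :: List.replicate (k - 1) false).length = k := by simp; omega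
      rw [e, List.getElem?_append_right (by omega), hlen, ih]
      constructor
      · rintro ⟨i, hi, hs⟩
        exact ⟨i + 1, by simpa using hi, by simp [hs]; omega⟩
      · rintro ⟨i, hi, hs⟩
        cases i with
        | zero => simp at hs; omega
        | succ i => exact ⟨i, by simpa using hi, by simp at hs; omega⟩

theorem indicator_blocks {n : ℕ} (C : Composition n) :
    indicator C.blocks = List.ofFn fun j : Fin n => decide (j.castSucc ∈ C.boundaries) := by
  have hp : ∀ k ∈ C.blocks, 0 < k := fun k hk => C.blocks_pos hk
  have hl : (indicator C.blocks).length = n := (length_indicator hp).trans C.blocks_sum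
  refine List.ext_getElem (by simp [hl]) fun j hj hj' => ?_
  have h := indicator_getElem?_eq_true hp j
  rw [List.getElem?_eq_getElem hj, Option.some_inj] at h
  rw [List.getElem_ofFn, Bool.eq_iff_iff, h, decide_eq_true_iff]
  have hn : j < n := hl ▸ hj
  constructor
  · rintro ⟨i, hi, hs⟩
    refine mem_map.2 ⟨⟨i, Nat.lt_succ_of_lt hi⟩, mem_univ _, ?_⟩
    exact Fin.ext hs
  · intro hm
    obtain ⟨i, -, hi⟩ := mem_map.1 hm
    have hi : C.sizeUpTo i = j := congrArg Fin.val hi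
    refine ⟨i, ?_, hi⟩
    by_contra hc
    rw [C.sizeUpTo_ofLength_le i (not_lt.1 hc)] at hi
    omega

theorem last_mem_boundaries {n : ℕ} (C : Composition n) : Fin.last n ∈ C.boundaries :=
  mem_map.2 ⟨Fin.last _, mem_univ _, C.boundary_last⟩

theorem zero_mem_boundaries {n : ℕ} (C : Composition n) : 0 ∈ C.boundaries :=
  mem_map.2 ⟨0, mem_univ _, C.boundary_zero⟩

theorem indicator_blocks_injective {n : ℕ} :
    Function.Injective fun C : Composition n => indicator C.blocks := by
  intro C C' h
  simp only [indicator_blocks, List.ofFn_inj] at h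
  refine (compositionEquiv n).injective (CompositionAsSet.ext ?_)
  change C.boundaries = C'.boundaries
  ext j
  induction j using Fin.lastCases with
  | last => simp [last_mem_boundaries]
  | cast j => simpa using congrFun h j

theorem indicator_blocks_succ {n : ℕ} (C : Composition (n + 1)) :
    indicator C.blocks =
      true :: List.ofFn fun j : Fin n => decide (j.succ.castSucc ∈ C.boundaries) := by
  rw [indicator_blocks, List.ofFn_succ]
  simp [zero_mem_boundaries]

theorem exists_composition_indicator (s : List Bool) :
    ∃ C : Composition (s.length + 1), indicator C.blocks = true :: s := by
  suffices h : ∃ k l, 0 < k ∧ (∀ i ∈ l, 0 < i) ∧ indicator (k :: l) = true :: s by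
    obtain ⟨k, l, hk, hl, h⟩ := h
    have hp : ∀ i ∈ k :: l, 0 < i := by simpa [hk] using hl
    refine ⟨⟨k :: l, fun {i} hi => hp i hi, ?_⟩, h⟩
    rw [← length_indicator hp, h, List.length_cons]
  induction s with
  | nil => exact ⟨1, [], by simp [indicator]⟩
  | cons b s ih =>
    obtain ⟨k, l, hk, hl, h⟩ := ih
    cases b with
    | true => exact ⟨1, k :: l, one_pos, by simpa [hk] using hl, by rw [← h]; rfl⟩
    | false =>
      refine ⟨k + 1, l, by omega, hl, ?_⟩
      obtain ⟨k, rfl⟩ := Nat.exists_eq_add_of_lt hk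
      simp only [indicator, List.flatMap_cons, List.cons_append, List.cons.injEq, true_and,
        zero_add, Nat.add_sub_cancel] at h ⊢
      rw [List.replicate_succ, List.cons_append, h]

theorem flatMap_indicator {l : List ℕ} (hl : ∀ k ∈ l, 0 < k) :
    (indicator l).flatMap (fun b => bif b then [true, false] else [false]) =
      l.flatMap fun k => true :: List.replicate k false := by
  induction l with
  | nil => rfl
  | cons k l ih =>
    obtain ⟨k, rfl⟩ := Nat.exists_eq_add_of_lt (hl k (by simp))
    rw [indicator, List.flatMap_cons, List.flatMap_append, ← indicator,
      ih fun k hk => hl k (by simp [hk])]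
    have h : ∀ m, (List.replicate m false).flatMap
        (fun b => bif b then [true, false] else [false]) = List.replicate m false := by
      intro m
      induction m with
      | zero => rfl
      | succ m ih => simp [List.replicate_succ, ih]
    simp [h, List.replicate_succ]

/-! ### Sums over coarsenings -/

/-- The words that are letterwise at most the given one. -/
def subwords : List Bool → Finset (List Bool)
  | [] => {[]}
  | false :: s => (subwords s).map ⟨List.cons false, List.cons_injective⟩
  | true :: s => (subwords s).map ⟨List.cons false, List.cons_injective⟩ ∪
      (subwords s).map ⟨List.cons true, List.cons_injective⟩

theorem mem_subwords {s t : List Bool} :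
    t ∈ subwords s ↔ List.Forall₂ (fun a b => a = true → b = true) t s := by
  induction s generalizing t with
  | nil => simp [subwords]
  | cons b s ih =>
    cases b
    · simp [subwords, List.forall₂_cons_right_iff, ih]
      grind
    · simp [subwords, List.forall₂_cons_right_iff, ih]
      grind

/-- `forestCount` as a function of the indicator word. -/
def indicatorCount : List Bool → ℕ → ℕ
  | [], _ => 1
  | false :: w, p => indicatorCount w (p + 1)
  | true :: w, p => ∑ q ∈ range p, indicatorCount w (q + 1)

theorem indicatorCount_replicate_false_append (l : ℕ) (w : List Bool) (p : ℕ) :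
    indicatorCount (List.replicate l false ++ w) p = indicatorCount w (p + l) := by
  induction l generalizing p with
  | zero => rfl
  | succ l ih =>
    rw [List.replicate_succ, List.cons_append, indicatorCount, ih]
    congr 1
    omega

theorem indicatorCount_indicator {l : List ℕ} (hl : ∀ k ∈ l, 0 < k) (p : ℕ) :
    indicatorCount (indicator l) p = forestCount p l := by
  induction l generalizing p with
  | nil => rfl
  | cons k l ih =>
    have hk := hl k (by simp)
    rw [indicator, List.flatMap_cons, List.cons_append, indicatorCount, forestCount]
    refine sum_congr rfl fun q _ => ?_
    rw [indicatorCount_replicate_false_append, ← indicator, ih fun k hk => hl k (by simp [hk])]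
    congr 1
    omega

/-- Keeping a letter `true` contributes `∑_{q < p} f (q+1)`, and replacing it by `false` contributes
`f (p+1)`. Together they give `∑_{q ≤ p} f (q+1)`, the operator of `true false` in `pathCount`. -/
theorem sum_subwords_indicatorCount (s : List Bool) (p : ℕ) :
    ∑ t ∈ subwords s, indicatorCount t p =
      pathCount (s.flatMap fun b => bif b then [true, false] else [false]) p := by
  induction s generalizing p with
  | nil => simp [subwords, indicatorCount, pathCount]
  | cons b s ih =>
    cases b
    · simp [subwords, indicatorCount, pathCount, ih]
    · rw [subwords, sum_union]
      · simp only [sum_map, Function.Embedding.coeFn_mk, indicatorCount, ih]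
        rw [sum_comm]
        simp [ih, pathCount, sum_range_succ, add_comm]
      · rw [disjoint_left]
        simp

/-- Coarsening a composition means changing some letters of its indicator word from `true` to
`false`. The first letter marks the boundary `0` and must be kept, so only the tail varies; in
degree `0` there is no first letter. -/
theorem sum_coarsenings_forestCount {n : ℕ} (C : Composition n) :
    ∑ J ∈ coarsenings C, forestCount 1 J.blocks = forestCount 1 (C.blocks.map (· + 1)) := by
  cases n with
  | zero =>
    have h : coarsenings C = univ := by
      refine filter_true_of_mem fun J _ => ?_
      rw [Composition.ext ((J.blocks_eq_nil.2 rfl).trans (C.blocks_eq_nil.2 rfl).symm)]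
    rw [h, sum_composition_zero (forestCount 1), C.blocks_eq_nil.2 rfl]
    rfl
  | succ n =>
    have hp : ∀ C : Composition (n + 1), ∀ k ∈ C.blocks, 0 < k :=
      fun C k hk => C.blocks_pos hk
    rw [forestCount_succ_map_succ, ← flatMap_indicator (hp C)]
    have hsub : ∀ J : Composition (n + 1), J ∈ coarsenings C ↔
        (indicator J.blocks).tail ∈ subwords (indicator C.blocks).tail := by
      intro J
      rw [coarsenings, mem_filter_univ, mem_subwords, indicator_blocks_succ,
        indicator_blocks_succ, List.forall₂_iff_get]
      simp only [List.tail_cons, List.length_ofFn, List.get_ofFn, true_and, subset_iff]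
      constructor
      · intro h i hi hi'
        exact fun hx => decide_eq_true (h (of_decide_eq_true hx))
      · intro h j
        induction j using Fin.cases with
        | zero => simp [zero_mem_boundaries]
        | succ j =>
          induction j using Fin.lastCases with
          | last => simp [last_mem_boundaries]
          | cast j =>
            exact fun hx => of_decide_eq_true (h j (by simp) (by simp) (decide_eq_true hx))
    have hbij : ∑ J ∈ coarsenings C, forestCount 1 J.blocks =
        ∑ t ∈ subwords (indicator C.blocks).tail, indicatorCount t 1 := by
      refine sum_bij (fun J _ => (indicator J.blocks).tail) (fun J hJ => (hsub J).1 hJ) ?_ ?_ ?_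
      · intro J _ J' _ h
        refine indicator_blocks_injective ?_
        simp only [indicator_blocks_succ, List.tail_cons] at h ⊢
        rw [h]
      · intro t ht
        have hlen : t.length = n := by
          have := (mem_subwords.1 ht).length_eq
          simpa [indicator_blocks_succ] using this
        subst hlen
        obtain ⟨J, hJ⟩ := exists_composition_indicator t
        exact ⟨J, (hsub J).2 (by rwa [hJ]), by rw [hJ, List.tail_cons]⟩
      · intro J _
        rw [← indicatorCount_indicator (hp J), indicator_blocks_succ]
        simp [indicatorCount]
    rw [hbij, sum_subwords_indicatorCount, indicator_blocks_succ]
    simp [pathCount]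

/-! ### Conjugation -/

theorem indicator_conjugate {n : ℕ} (C : Composition (n + 1)) :
    indicator (conjugate C).blocks =
      true :: transposeWord (indicator C.blocks).tail := by
  rw [indicator_blocks_succ, indicator_blocks_succ, List.tail_cons, conjugate,
    CompositionAsSet.toComposition_boundaries]
  congr 1
  refine List.ext_getElem (by simp [transposeWord]) fun j hj hj' => ?_
  have hn : j < n := by simpa using hj
  simp only [transposeWord, List.getElem_ofFn, List.getElem_reverse, List.getElem_map,
    mem_filter_univ, List.length_map, List.length_ofFn]
  have hrev : (Fin.succ ⟨j, hn⟩).castSucc.rev = (Fin.succ ⟨n - 1 - j, by omega⟩).castSucc := by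
    ext
    simp only [Fin.val_rev, Fin.val_castSucc, Fin.val_succ]
    omega
  have h0 : (Fin.succ ⟨j, hn⟩).castSucc ≠ 0 := by simp [Fin.ext_iff]
  have h1 : (Fin.succ ⟨j, hn⟩).castSucc ≠ Fin.last (n + 1) := by
    simp only [ne_eq, Fin.ext_iff, Fin.val_castSucc, Fin.val_succ, Fin.val_last]
    omega
  simp only [h0, h1, hrev, false_or, decide_not]

/-- Conjugation transposes the tail of the indicator word. The expansion of letters used for ribbons
is, up to one letter `true` moved from one end to the other, the transpose of the expansion used for
forests. -/
theorem pathCount_conjugate {n : ℕ} (C : Composition n) :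
    pathCount ((indicator (conjugate C).blocks).flatMap
      fun b => bif b then [true] else [false, true]) 0 =
    forestCount 1 (C.blocks.map (· + 1)) := by
  rw [forestCount_succ_map_succ, ← flatMap_indicator fun k hk => C.blocks_pos hk]
  cases n with
  | zero => simp [(Composition.blocks_eq_nil _).2, indicator]
  | succ n =>
    -- The leading `true` slides through the word, since `true · (false true) = (true false) ·
    -- true`.
    have key : ∀ t : List Bool, true :: (transposeWord t).flatMap
        (fun b => bif b then [true] else [false, true]) =
        transposeWord (t.flatMap fun b => bif b then [true, false] else [false]) ++ [true] := by
      intro t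
      induction t with
      | nil => rfl
      | cons b t ih =>
        have e : transposeWord (b :: t) = transposeWord t ++ [!b] := by simp [transposeWord]
        rw [e, List.flatMap_append, ← List.cons_append, ih]
        cases b <;> simp [transposeWord]
    rw [indicator_conjugate, indicator_blocks_succ C, ← pathCount_transposeWord, List.tail_cons,
      List.flatMap_cons, cond_true, List.singleton_append, key]
    rw [List.flatMap_cons, cond_true, List.cons_append, pathCount_true_zero]
    simp [transposeWord, Function.comp_def]


/-! ### Words bounded by their positions -/

/-- The `i`-th letter of the word (counting from `0`) is at most `m + i`. -/
def BoundedFrom : ℕ → List ℕ → Prop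
  | _, [] => True
  | m, x :: w => x ≤ m ∧ BoundedFrom (m + 1) w

theorem boundedFrom_append {m : ℕ} {u v : List ℕ} :
    BoundedFrom m (u ++ v) ↔ BoundedFrom m u ∧ BoundedFrom (m + u.length) v := by
  induction u generalizing m with
  | nil => simp [BoundedFrom]
  | cons x u ih =>
    rw [List.cons_append, BoundedFrom, BoundedFrom, ih, and_assoc, List.length_cons,
      show m + 1 + u.length = m + (u.length + 1) by omega]

theorem boundedFrom_iff {m : ℕ} {w : List ℕ} :
    BoundedFrom m w ↔ ∀ (i : ℕ) (hi : i < w.length), w[i] ≤ i + m := by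
  induction w generalizing m with
  | nil => simp [BoundedFrom]
  | cons x w ih =>
    rw [BoundedFrom, ih]
    constructor
    · rintro ⟨h0, h⟩ i hi
      cases i with
      | zero => simpa using h0
      | succ i =>
        have := h i (by simpa using hi)
        simp only [List.getElem_cons_succ]
        omega
    · intro h
      refine ⟨(h 0 (by simp)).trans_eq (zero_add m), fun i hi => ?_⟩
      have := h (i + 1) (by simpa using hi)
      simp only [List.getElem_cons_succ] at this
      omega

theorem boundedFrom_replicate {m x : ℕ} (h : x ≤ m) (k : ℕ) :
    BoundedFrom m (List.replicate k x) := by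
  rw [boundedFrom_iff]
  intro i hi
  rw [List.getElem_replicate]
  omega

theorem isParking_iff_of_sorted {w : List ℕ} (hw : w.Pairwise (· ≤ ·)) :
    IsParking w ↔ (∀ x ∈ w, 1 ≤ x) ∧ BoundedFrom 1 w := by
  have h : w.insertionSort (· ≤ ·) = w := hw.insertionSort_eq
  rw [IsParking, boundedFrom_iff]
  simp only [h]

/-! ### Nondecreasing parking functions -/

theorem packedEvaluation_replicate_append {k x : ℕ} (hk : 0 < k) {w : List ℕ}
    (hw : ∀ y ∈ w, x < y) :
    packedEvaluation (List.replicate k x ++ w) = k :: packedEvaluation w := by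
  have hx : x ∉ w := fun h => lt_irrefl _ (hw x h)
  have h : (List.replicate k x ++ w).toFinset = insert x w.toFinset := by
    ext y
    simp [hk.ne']
  rw [packedEvaluation, h, sort_insert _ (fun b hb => (hw b (by simpa using hb)).le)
    (by simpa using hx), List.map_cons, packedEvaluation]
  congr 1
  · simp [List.count_eq_zero_of_not_mem hx]
  · refine List.map_congr_left fun y hy => ?_
    have hy : y ∈ w := by simpa using hy
    have : x ≠ y := fun h => hx (h ▸ hy)
    simp [List.count_replicate, this]

theorem packedEvaluation_eq_nil {w : List ℕ} : packedEvaluation w = [] ↔ w = [] := by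
  rw [packedEvaluation, List.map_eq_nil_iff]
  constructor
  · intro h
    have h2 : w.toFinset = ∅ := by
      ext y
      rw [← mem_sort (· ≤ ·), h]
      simp
    simpa using h2
  · rintro rfl
    simp

theorem sorted_eq_replicate_append_filter {a : ℕ} {w : List ℕ} (hs : w.Pairwise (· ≤ ·))
    (hw : ∀ x ∈ w, a ≤ x) :
    w = List.replicate (w.count a) a ++ w.filter (a < ·) := by
  induction w with
  | nil => rfl
  | cons x w ih =>
    rw [List.pairwise_cons] at hs
    have ih := ih hs.2 fun x hx => hw x (by simp [hx])
    rcases eq_or_lt_of_le (hw x (by simp)) with rfl | h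
    · simpa [List.replicate_succ] using ih
    · have h1 : ∀ y ∈ x :: w, a < y := by
        intro y hy
        rcases List.mem_cons.1 hy with rfl | hy
        · exact h
        · exact h.trans_le (hs.1 y hy)
      have h2 : (x :: w).count a = 0 :=
        List.count_eq_zero_of_not_mem fun h => lt_irrefl _ (h1 a h)
      rw [h2, List.filter_eq_self.2 (by simpa using h1)]
      rfl

/-- The nondecreasing words of type `c` with letters above `a` whose `i`-th letter (counting
from `0`) is at most `m + i`. -/
def ndpfAbove (a m : ℕ) (c : List ℕ) : Set (List ℕ) :=
  {w | w.Pairwise (· ≤ ·) ∧ (∀ x ∈ w, a < x) ∧ BoundedFrom m w ∧ packedEvaluation w = c}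

/-- Either `a + 1` does not occur, or it is the least letter and forms an initial block of length
`k`. With `p = m - a`, these two cases lower `p` by one or replace it by `p - 1 + k`, as in the
forest recursion. -/
theorem ndpfAbove_cons {a m k : ℕ} (ham : a + 1 ≤ m) (hk : 0 < k) (c : List ℕ) :
    ndpfAbove a m (k :: c) = ndpfAbove (a + 1) m (k :: c) ∪
      (List.replicate k (a + 1) ++ ·) '' ndpfAbove (a + 1) (m + k) c := by
  ext w
  constructor
  · rintro ⟨hs, ha, hb, hc⟩
    by_cases hw : a + 1 ∈ w
    · right
      have e := sorted_eq_replicate_append_filter hs (a := a + 1) ha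
      have hlt : ∀ y ∈ w.filter (a + 1 < ·), a + 1 < y := fun y hy => by
        simpa using (List.mem_filter.1 hy).2
      have hcount : w.count (a + 1) = k ∧ packedEvaluation (w.filter (a + 1 < ·)) = c := by
        rw [e, packedEvaluation_replicate_append (List.count_pos_iff.2 hw) hlt] at hc
        simpa using hc
      rw [hcount.1] at e
      refine ⟨w.filter (a + 1 < ·), ⟨hs.filter _, hlt, ?_, hcount.2⟩, e.symm⟩
      rw [e, boundedFrom_append] at hb
      simpa using hb.2
    · left
      refine ⟨hs, fun x hx => ?_, hb, hc⟩
      have h1 := ha x hx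
      have h2 : x ≠ a + 1 := fun h => hw (h ▸ hx)
      omega
  · rintro (⟨hs, ha, hb, hc⟩ | ⟨w, ⟨hs, ha, hb, hc⟩, rfl⟩)
    · exact ⟨hs, fun x hx => by have := ha x hx; omega, hb, hc⟩
    · refine ⟨?_, ?_, ?_, ?_⟩
      · refine List.pairwise_append.2 ⟨List.pairwise_replicate.2 (by simp), hs, ?_⟩
        intro x hx y hy
        rw [List.eq_of_mem_replicate hx]
        exact (ha y hy).le
      · intro x hx
        rcases List.mem_append.1 hx with hx | hx
        · rw [List.eq_of_mem_replicate hx]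
          exact Nat.lt_succ_self a
        · have := ha x hx
          omega
      · rw [boundedFrom_append, List.length_replicate]
        exact ⟨boundedFrom_replicate ham k, hb⟩
      · rw [packedEvaluation_replicate_append hk ha, hc]

theorem encard_ndpfAbove {c : List ℕ} (hc : ∀ k ∈ c, 0 < k) {a m p : ℕ} (h : a + p = m) :
    (ndpfAbove a m c).encard = forestCount p c := by
  induction c generalizing a m p with
  | nil =>
    have : ndpfAbove a m [] = {[]} := by
      ext w
      simp only [ndpfAbove, packedEvaluation_eq_nil, Set.mem_ofPred_eq, Set.mem_singleton_iff]
      constructor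
      · exact fun h => h.2.2.2
      · rintro rfl
        simp [BoundedFrom]
    rw [this, Set.encard_singleton]
    rfl
  | cons k c ih =>
    have hk := hc k (by simp)
    induction p generalizing a with
    | zero =>
      have : ndpfAbove a m (k :: c) = ∅ := by
        refine Set.eq_empty_of_forall_notMem ?_
        rintro w ⟨-, ha, hb, hc⟩
        cases w with
        | nil => rw [packedEvaluation_eq_nil.2 rfl] at hc; cases hc
        | cons x w =>
          have := ha x (by simp)
          have := hb.1
          omega
      rw [this, Set.encard_empty, forestCount_zero_cons]
      rfl
    | succ p ihp =>
      rw [ndpfAbove_cons (by omega) hk, Set.encard_union_eq, ihp (by omega),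
        (List.append_right_injective _).encard_image,
        ih (fun k hk => hc k (by simp [hk])) (p := p + k) (by omega), forestCount_succ_cons]
      · push_cast
        rfl
      · rw [Set.disjoint_left]
        rintro _ ⟨-, ha, -⟩ ⟨w, -, rfl⟩
        have := ha (a + 1) (by simp [hk.ne'])
        omega

theorem encard_ndpfOfType {c : List ℕ} (hc : ∀ k ∈ c, 0 < k) :
    (ndpfOfType c).encard = forestCount 1 c := by
  rw [← encard_ndpfAbove hc (zero_add 1)]
  congr 1
  ext w
  constructor
  · rintro ⟨⟨hs, hp⟩, hc⟩
    rw [isParking_iff_of_sorted hs] at hp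
    exact ⟨hs, hp.1, hp.2, hc⟩
  · rintro ⟨hs, ha, hb, hc⟩
    exact ⟨⟨hs, (isParking_iff_of_sorted hs).2 ⟨ha, hb⟩⟩, hc⟩

/-! ### Plane trees -/

/-- The plane forests with `p` trees whose arities of internal nodes, read in prefix order,
form `c`. -/
def forestsOfType (p : ℕ) (c : List ℕ) : Set (List PlaneTree) :=
  {ts | ts.length = p ∧ (ts.map PlaneTree.arities).flatten.filter (fun k => k ≠ 0) = c}

theorem arities_node (ts : List PlaneTree) :
    (PlaneTree.node ts).arities = ts.length :: (ts.map PlaneTree.arities).flatten := by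
  rw [PlaneTree.arities]

/-- The forest whose first tree has the first `k` trees of the given one as its children. -/
def graft (k : ℕ) (ts : List PlaneTree) : List PlaneTree :=
  PlaneTree.node (ts.take k) :: ts.drop k

theorem graft_injective (k : ℕ) : Function.Injective (graft k) := by
  intro ts ts' h
  simp only [graft, List.cons.injEq, PlaneTree.node.injEq] at h
  rw [← List.take_append_drop k ts, h.1, h.2, List.take_append_drop]

theorem forestsOfType_succ_nil (p : ℕ) :
    forestsOfType (p + 1) [] = List.cons (PlaneTree.node []) '' forestsOfType p [] := by
  ext ts
  constructor
  · rintro ⟨hl, hc⟩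
    rcases ts with _ | ⟨⟨us⟩, ts⟩
    · simp at hl
    · rcases us with _ | ⟨u, us⟩
      · exact ⟨ts, ⟨by simpa using hl, by simpa [arities_node] using hc⟩, rfl⟩
      · simp [arities_node] at hc
  · rintro ⟨ts, ⟨hl, hc⟩, rfl⟩
    exact ⟨by simpa using hl, by simpa [arities_node] using hc⟩

/-- Deleting an internal root and putting its children in front of the remaining trees does not
change the prefix order of the other nodes. -/
theorem forestsOfType_succ_cons {p k : ℕ} (hk : 0 < k) (c : List ℕ) :
    forestsOfType (p + 1) (k :: c) =
      List.cons (PlaneTree.node []) '' forestsOfType p (k :: c) ∪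
        graft k '' forestsOfType (p + k) c := by
  ext ts
  constructor
  · rintro ⟨hl, hc⟩
    rcases ts with _ | ⟨⟨us⟩, ts⟩
    · simp at hl
    · rcases eq_or_ne us [] with rfl | hus
      · exact Or.inl ⟨ts, ⟨by simpa using hl, by simpa [arities_node] using hc⟩, rfl⟩
      · right
        have hl : ts.length = p := by simpa using hl
        rw [List.map_cons, List.flatten_cons, arities_node, List.cons_append,
          List.filter_cons_of_pos (by simpa using hus), List.cons.injEq,
          ← List.flatten_append, ← List.map_append] at hc
        refine ⟨us ++ ts, ⟨?_, hc.2⟩, ?_⟩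
        · rw [List.length_append, hc.1, hl, add_comm]
        · rw [graft, List.take_left' hc.1, List.drop_left' hc.1]
  · rintro (⟨ts, ⟨hl, hc⟩, rfl⟩ | ⟨ts, ⟨hl, hc⟩, rfl⟩)
    · exact ⟨by simpa using hl, by simpa [arities_node] using hc⟩
    · have hk' : (ts.take k).length = k := by
        rw [List.length_take]
        omega
      refine ⟨by simp [graft, hl], ?_⟩
      rw [graft, List.map_cons, List.flatten_cons, arities_node, List.cons_append,
        List.filter_cons_of_pos (by rw [hk']; simpa using hk.ne'), ← List.flatten_append,
        ← List.map_append, List.take_append_drop, hc, hk']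

theorem encard_forestsOfType {c : List ℕ} (hc : ∀ k ∈ c, 0 < k) (p : ℕ) :
    (forestsOfType p c).encard = forestCount p c := by
  induction c generalizing p with
  | nil =>
    induction p with
    | zero =>
      have : forestsOfType 0 [] = {[]} := by
        ext ts
        simp only [forestsOfType, List.length_eq_zero_iff, Set.mem_ofPred_eq,
          Set.mem_singleton_iff]
        constructor
        · exact fun h => h.1
        · rintro rfl
          simp
      rw [this, Set.encard_singleton]
      rfl
    | succ p ih =>
      rw [forestsOfType_succ_nil, List.cons_injective.encard_image, ih]
      rfl
  | cons k c ih =>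
    have hk := hc k (by simp)
    induction p with
    | zero =>
      have : forestsOfType 0 (k :: c) = ∅ := by
        refine Set.eq_empty_of_forall_notMem ?_
        rintro ts ⟨hl, hc⟩
        rw [List.length_eq_zero_iff] at hl
        simp [hl] at hc
      rw [this, Set.encard_empty, forestCount_zero_cons]
      rfl
    | succ p ihp =>
      rw [forestsOfType_succ_cons hk, Set.encard_union_eq, List.cons_injective.encard_image, ihp,
        (graft_injective k).encard_image, ih (fun k hk => hc k (by simp [hk])),
        forestCount_succ_cons]
      · push_cast
        rfl
      · rw [Set.disjoint_left]
        rintro _ ⟨ts, -, rfl⟩ ⟨ts', ⟨hl, -⟩, h⟩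
        simp only [graft, List.cons.injEq, PlaneTree.node.injEq, List.take_eq_nil_iff] at h
        rcases h.1 with h | h
        · omega
        · simp [h] at hl
          omega

theorem encard_planeTreesOfType {c : List ℕ} (hc : ∀ k ∈ c, 0 < k) :
    (planeTreesOfType c).encard = forestCount 1 c := by
  rw [← encard_forestsOfType hc]
  have h : forestsOfType 1 c = (fun T => [T]) '' planeTreesOfType c := by
    ext ts
    constructor
    · rintro ⟨hl, hc⟩
      obtain ⟨T, rfl⟩ := List.length_eq_one_iff.1 hl
      exact ⟨T, by simpa [planeTreesOfType] using hc, rfl⟩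
    · rintro ⟨T, hT, rfl⟩
      exact ⟨rfl, by simpa [planeTreesOfType] using hT⟩
  rw [h, Function.Injective.encard_image]
  exact fun T T' h => by simpa using h

/-! ### Parking quasi-ribbons -/

/-- The fillings of the ribbon diagram with the given indicator word whose `i`-th entry (counting
from `0`) is at most `m + i`, as words, where the entry preceding the first one is `a`. -/
def IsRibbonFilling : ℕ → ℕ → List Bool → List ℕ → Prop
  | _, _, [], [] => True
  | a, m, b :: bs, x :: w => (bif b then a + 1 else a) ≤ x ∧ x ≤ m ∧ IsRibbonFilling x (m + 1) bs w
  | _, _, _, _ => False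

theorem IsRibbonFilling.length_eq {a m : ℕ} {bs : List Bool} {w : List ℕ}
    (h : IsRibbonFilling a m bs w) : w.length = bs.length := by
  induction bs generalizing a m w with
  | nil => cases w <;> simp_all [IsRibbonFilling]
  | cons b bs ih =>
    cases w with
    | nil => simp [IsRibbonFilling] at h
    | cons x w => simpa using ih h.2.2

/-- The parameter `p` measures the room between the previous entry and the bound. After an entry `x`
it becomes `q = m - x`, which ranges over `q ≤ p` for a strict step and over `q ≤ p + 1` for a weak
one; these are the operators `true` and `false true`. -/
theorem encard_isRibbonFilling (bs : List Bool) {a m p : ℕ} (h : a + p + 1 = m) :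
    {w | IsRibbonFilling a m bs w}.encard =
      pathCount (bs.flatMap fun b => bif b then [true] else [false, true]) p := by
  induction bs generalizing a m p with
  | nil =>
    have : {w | IsRibbonFilling a m [] w} = {[]} := by
      ext w
      cases w <;> simp [IsRibbonFilling]
    rw [this, Set.encard_singleton]
    rfl
  | cons b bs ih =>
    have key : ∀ p a, a + p = m + 1 →
        {w | ∃ x v, w = x :: v ∧ a ≤ x ∧ x ≤ m ∧ IsRibbonFilling x (m + 1) bs v}.encard =
          ((∑ q ∈ range p, pathCount
            (bs.flatMap fun b => bif b then [true] else [false, true]) q : ℕ) : ℕ∞) := by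
      intro p
      induction p with
      | zero =>
        intro a ha
        rw [range_zero, sum_empty, Nat.cast_zero, Set.encard_eq_zero]
        refine Set.eq_empty_of_forall_notMem ?_
        rintro _ ⟨x, v, rfl, h1, h2, -⟩
        omega
      | succ p ihp =>
        intro a ha
        have e : {w | ∃ x v, w = x :: v ∧ a ≤ x ∧ x ≤ m ∧ IsRibbonFilling x (m + 1) bs v} =
            {w | ∃ x v, w = x :: v ∧ a + 1 ≤ x ∧ x ≤ m ∧ IsRibbonFilling x (m + 1) bs v} ∪
              List.cons a '' {v | IsRibbonFilling a (m + 1) bs v} := by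
          ext w
          constructor
          · rintro ⟨x, v, rfl, h1, h2, h3⟩
            rcases eq_or_lt_of_le h1 with rfl | h1
            · exact Or.inr ⟨v, h3, rfl⟩
            · exact Or.inl ⟨x, v, rfl, h1, h2, h3⟩
          · rintro (⟨x, v, rfl, h1, h2, h3⟩ | ⟨v, hv, rfl⟩)
            · exact ⟨x, v, rfl, by omega, h2, h3⟩
            · exact ⟨a, v, rfl, le_rfl, by omega, hv⟩
        rw [e, Set.encard_union_eq, ihp (a + 1) (by omega), List.cons_injective.encard_image,
          ih (p := p) (by omega), sum_range_succ]
        · push_cast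
          rfl
        · rw [Set.disjoint_left]
          rintro _ ⟨x, v, rfl, h1, -⟩ ⟨v', -, h⟩
          have := (List.cons.inj h).1
          omega
    have e : {w | IsRibbonFilling a m (b :: bs) w} = {w | ∃ x v, w = x :: v ∧
        (bif b then a + 1 else a) ≤ x ∧ x ≤ m ∧ IsRibbonFilling x (m + 1) bs v} := by
      ext w
      cases w <;> simp [IsRibbonFilling]
    rw [e]
    cases b
    · rw [key (p + 2) _ (by simp; omega)]
      simp [pathCount]
    · rw [key (p + 1) _ (by simp; omega)]
      simp [pathCount]

theorem isRibbonFilling_replicate_false_append {a m : ℕ} {bs : List Bool} {r w : List ℕ} :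
    IsRibbonFilling a m (List.replicate r.length false ++ bs) (r ++ w) ↔
      (a :: r).IsChain (· ≤ ·) ∧ BoundedFrom m r ∧
        IsRibbonFilling ((a :: r).getLast (by simp)) (m + r.length) bs w := by
  induction r generalizing a m with
  | nil => simp [BoundedFrom]
  | cons x r ih =>
    rw [List.length_cons, List.replicate_succ, List.cons_append, List.cons_append,
      IsRibbonFilling, ih, BoundedFrom, List.isChain_cons_cons, List.getLast_cons_cons,
      show m + 1 + r.length = m + (r.length + 1) by omega]
    simp only [cond_false]
    tauto

theorem isRibbonFilling_flatten {a m : ℕ} {rows : List (List ℕ)} (hr : [] ∉ rows) :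
    IsRibbonFilling a m (indicator (rows.map List.length)) rows.flatten ↔
      (∀ r ∈ rows, r.Pairwise (· ≤ ·)) ∧
        rows.IsChain (fun r s => ∀ x ∈ r.getLast?, ∀ y ∈ s.head?, x < y) ∧
          (∀ x ∈ rows.flatten.head?, a < x) ∧ BoundedFrom m rows.flatten := by
  induction rows generalizing a m with
  | nil => simp [indicator, IsRibbonFilling, BoundedFrom]
  | cons r rows ih =>
    rcases r with _ | ⟨x, r⟩
    · simp at hr
    have hr' : [] ∉ rows := fun h => hr (by simp [h])
    have ih := @ih ((x :: r).getLast (by simp)) (m + 1 + r.length) hr'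
    have e : indicator (((x :: r) :: rows).map List.length) =
        true :: (List.replicate r.length false ++ indicator (rows.map List.length)) := by
      simp [indicator]
    have hchain : ((x :: r) :: rows).IsChain
        (fun r s => ∀ x ∈ r.getLast?, ∀ y ∈ s.head?, x < y) ↔
        (∀ y ∈ rows.flatten.head?, (x :: r).getLast (by simp) < y) ∧
          rows.IsChain (fun r s => ∀ x ∈ r.getLast?, ∀ y ∈ s.head?, x < y) := by
      rcases rows with _ | ⟨s, rows⟩
      · simp
      · rcases s with _ | ⟨y, s⟩
        · simp at hr'
        · rw [List.isChain_cons_cons, List.getLast?_eq_getLast_of_ne_nil (by simp)]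
          simp
    rw [e, List.flatten_cons, List.cons_append, IsRibbonFilling,
      isRibbonFilling_replicate_false_append, ih, hchain, BoundedFrom, boundedFrom_append,
      List.isChain_iff_pairwise, List.forall_mem_cons]
    simp only [cond_true, List.head?_cons, Option.mem_some_iff, forall_eq', Nat.succ_le_iff]
    tauto

/-- Weak increase along rows and strict increase between them make the flattened word nondecreasing,
so the parking condition reduces to bounds at each position. The initial letter `true` with previous
entry `0` makes the first entry, hence every entry, positive. -/
theorem flatten_image_parkingQuasiRibbons {n : ℕ} (I : Composition n) :
    List.flatten '' parkingQuasiRibbons I =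
      {w | IsRibbonFilling 0 1 (indicator I.blocks) w} := by
  have hne : ∀ rows : List (List ℕ), rows.map List.length = I.blocks → [] ∉ rows := by
    intro rows h hr
    have : 0 ∈ I.blocks := by
      rw [← h]
      exact List.mem_map.2 ⟨[], hr, rfl⟩
    exact lt_irrefl _ (I.blocks_pos this)
  have hsorted : ∀ rows : List (List ℕ), [] ∉ rows → (∀ r ∈ rows, r.Pairwise (· ≤ ·)) →
      rows.IsChain (fun r s => ∀ x ∈ r.getLast?, ∀ y ∈ s.head?, x < y) →
      rows.flatten.Pairwise (· ≤ ·) := by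
    intro rows h0 h1 h2
    rw [← List.isChain_iff_pairwise, List.isChain_flatten h0]
    refine ⟨fun r hr => List.isChain_iff_pairwise.2 (h1 r hr), h2.imp ?_⟩
    exact fun r s h x hx y hy => (h x hx y hy).le
  ext w
  constructor
  · rintro ⟨rows, ⟨hl, h1, h2, h3⟩, rfl⟩
    rw [isParking_iff_of_sorted (hsorted rows (hne rows hl) h1 h2)] at h3
    rw [Set.mem_ofPred_eq, ← hl, isRibbonFilling_flatten (hne rows hl)]
    exact ⟨h1, h2, fun x hx => h3.1 x (List.mem_of_mem_head? hx), h3.2⟩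
  · intro hw
    rw [Set.mem_ofPred_eq] at hw
    have hlen : I.blocks.sum = w.length := by
      rw [hw.length_eq, length_indicator fun k hk => I.blocks_pos hk]
    have hl := List.map_splitLengths_length w I.blocks hlen.le
    have hf := List.flatten_splitLengths w I.blocks hlen.ge
    set rows := I.blocks.splitLengths w with hrows
    rw [← hl, ← hf, isRibbonFilling_flatten (hne rows hl)] at hw
    obtain ⟨h1, h2, h3, h4⟩ := hw
    have hs := hsorted rows (hne rows hl) h1 h2
    refine ⟨rows, ⟨hl, h1, h2, (isParking_iff_of_sorted hs).2 ⟨?_, h4⟩⟩, hf⟩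
    intro x hx
    cases hfl : rows.flatten with
    | nil => simp [hfl] at hx
    | cons y v =>
      rw [hfl] at hs h3 hx
      have hy : 0 < y := h3 y (by simp)
      rcases List.mem_cons.1 hx with rfl | hx
      · exact hy
      · exact hy.trans_le ((List.pairwise_cons.1 hs).1 x hx)

theorem encard_parkingQuasiRibbons {n : ℕ} (I : Composition n) :
    (parkingQuasiRibbons I).encard = pathCount
      ((indicator I.blocks).flatMap fun b => bif b then [true] else [false, true]) 0 := by
  rw [← encard_isRibbonFilling (indicator I.blocks) (a := 0) (m := 1) rfl,
    ← flatten_image_parkingQuasiRibbons, Set.InjOn.encard_image]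
  rintro rows ⟨hl, -⟩ rows' ⟨hl', -⟩ h
  exact List.eq_iff_flatten_eq.2 ⟨h, hl.trans hl'.symm⟩


/-! ### Binary search trees -/

/-- Binary trees with nodes labelled by natural numbers. -/
inductive LabelledTree : Type
  | leaf : LabelledTree
  | node : LabelledTree → ℕ → LabelledTree → LabelledTree
  deriving DecidableEq

namespace LabelledTree

/-- The labels in infix order. -/
def toList : LabelledTree → List ℕ
  | leaf => []
  | node l x r => l.toList ++ x :: r.toList

/-- The labels in postfix order. -/
def postfixReading : LabelledTree → List ℕ
  | leaf => []
  | node l x r => l.postfixReading ++ (r.postfixReading ++ [x])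

/-- Binary search trees: the label of a node is at least the labels of its left subtree, and less
than those of its right subtree. -/
def IsSearch : LabelledTree → Prop
  | leaf => True
  | node l x r => (∀ y ∈ l.toList, y ≤ x) ∧ (∀ y ∈ r.toList, x < y) ∧ l.IsSearch ∧ r.IsSearch

/-- Insertion of a letter into a binary search tree. -/
def insert (a : ℕ) : LabelledTree → LabelledTree
  | leaf => node leaf a leaf
  | node l x r => if a ≤ x then node (l.insert a) x r else node l x (r.insert a)

theorem toList_insert_perm (a : ℕ) (T : LabelledTree) :
    (T.insert a).toList.Perm (a :: T.toList) := by
  induction T with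
  | leaf => exact List.Perm.refl _
  | node l x r ihl ihr =>
    rw [insert]
    split_ifs
    · exact ihl.append_right _
    · exact ((ihr.cons x).append_left _).trans
        (((List.Perm.swap a x _).append_left _).trans List.perm_middle)

theorem mem_toList_insert {a y : ℕ} {T : LabelledTree} :
    y ∈ (T.insert a).toList ↔ y = a ∨ y ∈ T.toList := by
  rw [(toList_insert_perm a T).mem_iff, List.mem_cons]

theorem IsSearch.insert {T : LabelledTree} (hT : T.IsSearch) (a : ℕ) : (T.insert a).IsSearch := by
  induction T with
  | leaf => simp [LabelledTree.insert, IsSearch, toList]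
  | node l x r ihl ihr =>
    obtain ⟨h1, h2, h3, h4⟩ := hT
    rw [LabelledTree.insert]
    split_ifs with h
    · refine ⟨fun y hy => ?_, h2, ihl h3, h4⟩
      rcases mem_toList_insert.1 hy with rfl | hy
      · exact h
      · exact h1 y hy
    · refine ⟨h1, fun y hy => ?_, h3, ihr h4⟩
      rcases mem_toList_insert.1 hy with rfl | hy
      · exact not_le.1 h
      · exact h2 y hy

/-- The label `b` separates `a` from `c`, so their insertion paths part at the latest at a node
labelled `b`. Until then both letters and `b` lie on the same side; afterwards the insertions take
place in disjoint subtrees. -/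
theorem insert_comm {a b c : ℕ} (hab : a ≤ b) (hbc : b < c) {T : LabelledTree} (hT : T.IsSearch)
    (hb : b ∈ T.toList) : (T.insert c).insert a = (T.insert a).insert c := by
  induction T with
  | leaf => simp [toList] at hb
  | node l x r ihl ihr =>
    obtain ⟨h1, h2, h3, h4⟩ := hT
    rw [toList, List.mem_append, List.mem_cons] at hb
    by_cases hc : c ≤ x
    · have ha : a ≤ x := by omega
      have hb : b ∈ l.toList := by
        rcases hb with hb | hb | hb
        · exact hb
        · omega
        · have := h2 b hb
          omega
      simp [insert, hc, ha, ihl h3 hb]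
    · by_cases ha : a ≤ x
      · simp [insert, hc, ha]
      · have hb : b ∈ r.toList := by
          rcases hb with hb | hb | hb
          · have := h1 b hb
            omega
          · omega
          · exact hb
        simp [insert, hc, ha, ihr h4 hb]

/-! ### Sylvester classes and insertion trees -/

/-- The binary search tree of a word, obtained by inserting its letters from right to left. -/
def ofWord (w : List ℕ) : LabelledTree := w.foldr insert leaf

theorem ofWord_cons (a : ℕ) (w : List ℕ) : ofWord (a :: w) = (ofWord w).insert a := rfl

theorem isSearch_ofWord (w : List ℕ) : (ofWord w).IsSearch := by
  induction w with
  | nil => trivial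
  | cons a w ih => exact ih.insert a

theorem toList_ofWord_perm (w : List ℕ) : (ofWord w).toList.Perm w := by
  induction w with
  | nil => exact List.Perm.refl _
  | cons a w ih => exact (toList_insert_perm a _).trans (ih.cons a)

theorem postfixReading_perm (T : LabelledTree) : T.postfixReading.Perm T.toList := by
  induction T with
  | leaf => exact List.Perm.refl _
  | node l x r ihl ihr =>
    exact ihl.append ((ihr.append_right _).trans (List.perm_append_singleton _ _))

theorem ofWord_eq_of_sylvesterStep {w w' : List ℕ} (h : SylvesterStep w w') :
    ofWord w = ofWord w' := by
  obtain ⟨u, v, w, a, b, c, hab, hbc⟩ := h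
  rw [ofWord, ofWord, List.foldr_append, List.foldr_append]
  congr 1
  refine insert_comm hab hbc (isSearch_ofWord _) ?_
  rw [← ofWord, (toList_ofWord_perm _).mem_iff]
  simp

theorem quot_append {w w' : List ℕ} (u v : List ℕ)
    (h : Quot.mk SylvesterStep w = Quot.mk SylvesterStep w') :
    Quot.mk SylvesterStep (u ++ w ++ v) = Quot.mk SylvesterStep (u ++ w' ++ v) := by
  refine congrArg (Quot.map (fun w => u ++ w ++ v) ?_) h
  rintro _ _ ⟨u', v', w', a, b, c, hab, hbc⟩
  have := SylvesterStep.swap (u ++ u') v' (w' ++ v) a b c hab hbc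
  simpa [List.append_assoc] using this

/-- The final letter `x` serves as the middle letter of the rewriting: each `y` in `l` satisfies `y
≤ x < a`, so `a` commutes past it. -/
theorem quot_cons_append {a x : ℕ} (hx : x < a) {l : List ℕ} (hl : ∀ y ∈ l, y ≤ x) (v : List ℕ) :
    Quot.mk SylvesterStep (a :: (l ++ (v ++ [x]))) =
      Quot.mk SylvesterStep (l ++ a :: (v ++ [x])) := by
  induction l with
  | nil => rfl
  | cons y l ih =>
    have h1 := Quot.sound (SylvesterStep.swap [] (l ++ v) [] y x a (hl y (by simp)) hx)
    have h2 := quot_append [y] [] (ih fun y hy => hl y (by simp [hy]))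
    simp only [List.append_assoc, List.nil_append, List.append_nil, List.cons_append] at h1 h2 ⊢
    rw [← h1, h2]

/-- If `a` goes left, the statement for the left subtree suffices. If it goes right, it must first
pass the reading of the left subtree, which is permitted because the root, read last, separates the
two. -/
theorem quot_cons_postfixReading {T : LabelledTree} (hT : T.IsSearch) (a : ℕ) :
    Quot.mk SylvesterStep (a :: T.postfixReading) =
      Quot.mk SylvesterStep (T.insert a).postfixReading := by
  induction T with
  | leaf => rfl
  | node l x r ihl ihr =>
    obtain ⟨h1, h2, h3, h4⟩ := hT
    rw [insert]
    split_ifs with h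
    · simpa [postfixReading] using quot_append [] (r.postfixReading ++ [x]) (ihl h3)
    · rw [postfixReading, quot_cons_append (not_le.1 h)
        fun y hy => h1 y ((postfixReading_perm l).mem_iff.1 hy)]
      simpa [postfixReading] using quot_append l.postfixReading [x] (ihr h4)

theorem quot_postfixReading_ofWord (w : List ℕ) :
    Quot.mk SylvesterStep w = Quot.mk SylvesterStep (ofWord w).postfixReading := by
  induction w with
  | nil => rfl
  | cons a w ih =>
    rw [ofWord_cons, ← quot_cons_postfixReading (isSearch_ofWord w)]
    simpa using quot_append [a] [] ih

theorem foldr_insert_of_le {x : ℕ} {u : List ℕ} (hu : ∀ y ∈ u, y ≤ x) (l r : LabelledTree) :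
    u.foldr insert (node l x r) = node (u.foldr insert l) x r := by
  induction u with
  | nil => rfl
  | cons y u ih =>
    rw [List.foldr_cons, ih fun y hy => hu y (by simp [hy]), insert, if_pos (hu y (by simp)),
      List.foldr_cons]

theorem foldr_insert_of_lt {x : ℕ} {u : List ℕ} (hu : ∀ y ∈ u, x < y) (l r : LabelledTree) :
    u.foldr insert (node l x r) = node l x (u.foldr insert r) := by
  induction u with
  | nil => rfl
  | cons y u ih =>
    rw [List.foldr_cons, ih fun y hy => hu y (by simp [hy]), insert,
      if_neg (not_le.2 (hu y (by simp))), List.foldr_cons]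

/-- The root is read last and hence inserted first; the letters of the right subtree and then those
of the left one descend to their own sides. -/
theorem ofWord_postfixReading {T : LabelledTree} (hT : T.IsSearch) :
    ofWord T.postfixReading = T := by
  induction T with
  | leaf => rfl
  | node l x r ihl ihr =>
    obtain ⟨h1, h2, h3, h4⟩ := hT
    rw [postfixReading, ofWord, List.foldr_append, List.foldr_append, List.foldr_cons,
      List.foldr_nil, insert,
      foldr_insert_of_lt fun y hy => h2 y ((postfixReading_perm r).mem_iff.1 hy),
      foldr_insert_of_le fun y hy => h1 y ((postfixReading_perm l).mem_iff.1 hy),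
      ← ofWord, ← ofWord, ihl h3, ihr h4]

theorem IsSearch.pairwise_toList {T : LabelledTree} (hT : T.IsSearch) :
    T.toList.Pairwise (· ≤ ·) := by
  induction T with
  | leaf => exact List.Pairwise.nil
  | node l x r ihl ihr =>
    obtain ⟨h1, h2, h3, h4⟩ := hT
    refine List.pairwise_append.2
      ⟨ihl h3, List.pairwise_cons.2 ⟨fun y hy => (h2 y hy).le, ihr h4⟩, fun y hy z hz => ?_⟩
    rcases List.mem_cons.1 hz with rfl | hz
    · exact h1 y hy
    · exact (h1 y hy).trans (h2 z hz).le

/-! ### Enumeration of binary search trees -/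

/-- The number of nodes on the leftmost branch. -/
def leftBranch : LabelledTree → ℕ
  | leaf => 0
  | node l _ _ => l.leftBranch + 1

/-- Add a new first node in infix order, keeping the first `p` nodes of the leftmost branch; the
subtree below them becomes the right subtree of the new node. -/
def addFirst (x : ℕ) : ℕ → LabelledTree → LabelledTree
  | p + 1, node l y r => node (addFirst x p l) y r
  | _, T => node leaf x T

theorem addFirst_zero (x : ℕ) (T : LabelledTree) : addFirst x 0 T = node leaf x T := by
  cases T <;> rfl

theorem leftBranch_addFirst {x p : ℕ} {T : LabelledTree} (hp : p ≤ T.leftBranch) :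
    (addFirst x p T).leftBranch = p + 1 := by
  induction T generalizing p with
  | leaf =>
    obtain rfl : p = 0 := by simpa [leftBranch] using hp
    rfl
  | node l y r ihl =>
    cases p with
    | zero => rfl
    | succ p => rw [addFirst, leftBranch, ihl (by simpa [leftBranch] using hp)]

theorem toList_addFirst {x p : ℕ} {T : LabelledTree} (hp : p ≤ T.leftBranch) :
    (addFirst x p T).toList = x :: T.toList := by
  induction T generalizing p with
  | leaf =>
    obtain rfl : p = 0 := by simpa [leftBranch] using hp
    rfl
  | node l y r ihl =>
    cases p with
    | zero => rfl
    | succ p => rw [addFirst, toList, ihl (by simpa [leftBranch] using hp)]; rfl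

/-- The subtree that becomes the right subtree of the new node must have labels greater than `x`.
This is automatic if `x` is strictly minimal, and also at the end of the leftmost branch, where that
subtree is empty. -/
theorem IsSearch.addFirst {x p : ℕ} {T : LabelledTree} (hT : T.IsSearch)
    (hx : ∀ z ∈ T.toList, x ≤ z) (hp : p ≤ T.leftBranch)
    (h : (∀ z ∈ T.toList, x < z) ∨ p = T.leftBranch) : (addFirst x p T).IsSearch := by
  induction T generalizing p with
  | leaf =>
    obtain rfl : p = 0 := by simpa [leftBranch] using hp
    simp [LabelledTree.addFirst, IsSearch, toList]
  | node l y r ihl =>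
    cases p with
    | zero =>
      have h : ∀ z ∈ (node l y r).toList, x < z := h.resolve_right (by simp [leftBranch])
      exact ⟨by simp [toList], h, trivial, hT⟩
    | succ p =>
      have hp : p ≤ l.leftBranch := by simpa [leftBranch] using hp
      obtain ⟨h1, h2, h3, h4⟩ := hT
      refine ⟨?_, h2, ihl h3 (fun z hz => hx z (by simp [toList, hz])) hp ?_, h4⟩
      · intro z hz
        rw [toList_addFirst hp] at hz
        rcases List.mem_cons.1 hz with rfl | hz
        · exact hx y (by simp [toList])
        · exact h1 z hz
      · exact h.imp (fun h z hz => h z (by simp [toList, hz]))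
          fun h => by simpa [leftBranch] using h

theorem addFirst_inj {x p : ℕ} {T T' : LabelledTree} (hp : p ≤ T.leftBranch)
    (hp' : p ≤ T'.leftBranch) (h : addFirst x p T = addFirst x p T') : T = T' := by
  induction p generalizing T T' with
  | zero => simpa [addFirst_zero] using h
  | succ p ih =>
    cases T with
    | leaf => simp [leftBranch] at hp
    | node l y r =>
      cases T' with
      | leaf => simp [leftBranch] at hp'
      | node l' y' r' =>
        simp only [addFirst, node.injEq] at h
        rw [ih (by simpa [leftBranch] using hp) (by simpa [leftBranch] using hp') h.1, h.2.1,
          h.2.2]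

/-- Remove the leftmost node and put its right subtree in its place; `p` is the number of its
ancestors. -/
theorem IsSearch.exists_eq_addFirst {x : ℕ} {s : List ℕ} {T : LabelledTree} (hT : T.IsSearch)
    (hs : T.toList = x :: s) : ∃ p T', p ≤ T'.leftBranch ∧ T'.IsSearch ∧
      ((∀ z ∈ T'.toList, x < z) ∨ p = T'.leftBranch) ∧ T = LabelledTree.addFirst x p T' := by
  induction T generalizing s with
  | leaf => simp [toList] at hs
  | node l y r ihl =>
    obtain ⟨h1, h2, h3, h4⟩ := hT
    cases hl : l.toList with
    | nil =>
      have : l = leaf := by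
        cases l with
        | leaf => rfl
        | node => simp [toList] at hl
      subst this
      simp only [toList, List.nil_append, List.cons.injEq] at hs
      obtain ⟨rfl, rfl⟩ := hs
      exact ⟨0, r, Nat.zero_le _, h4, Or.inl h2, (addFirst_zero _ _).symm⟩
    | cons x' s' =>
      rw [toList, hl, List.cons_append, List.cons.injEq] at hs
      obtain ⟨rfl, hs⟩ := hs
      obtain ⟨p, l', hp, hl', hor, rfl⟩ := ihl h3 hl
      rw [toList_addFirst hp] at h1
      refine ⟨p + 1, node l' y r, by simpa [leftBranch] using hp,
        ⟨fun z hz => h1 z (by simp [hz]), h2, hl', h4⟩, ?_, rfl⟩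
      by_cases hpl : p = l'.leftBranch
      · exact Or.inr (by rw [hpl]; rfl)
      · left
        have hor := hor.resolve_right hpl
        -- Since `p` is not maximal, `l'` is nonempty; any label in it lies above `x'` and is at
        -- most `y`.
        have hxy : x' < y := by
          cases l' with
          | leaf => simp [leftBranch] at hp hpl; omega
          | node l'' z r'' =>
            have hz : z ∈ (node l'' z r'').toList := by simp [toList]
            exact (hor z hz).trans_le (h1 z (by simp [hz]))
        intro z hz
        rw [toList, List.mem_append, List.mem_cons] at hz
        rcases hz with hz | rfl | hz
        · exact hor z hz
        · exact hxy
        · exact hxy.trans (h2 z hz)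

/-- The binary search trees whose infix reading is the given nondecreasing word. -/
def searchTrees : List ℕ → Finset LabelledTree
  | [] => {leaf}
  | x :: s => ((searchTrees s).sigma fun T =>
      if ∀ z ∈ s, x < z then range (T.leftBranch + 1) else {T.leftBranch}).image
        fun y => addFirst x y.2 y.1

theorem mem_sigma_searchTrees {x : ℕ} {s : List ℕ} {T : LabelledTree} {p : ℕ} :
    (⟨T, p⟩ : (_ : LabelledTree) × ℕ) ∈ ((searchTrees s).sigma fun T =>
      if ∀ z ∈ s, x < z then range (T.leftBranch + 1) else {T.leftBranch}) ↔
    T ∈ searchTrees s ∧ p ≤ T.leftBranch ∧ ((∀ z ∈ s, x < z) ∨ p = T.leftBranch) := by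
  rw [mem_sigma]
  refine and_congr_right fun _ => ?_
  split_ifs with h
  · rw [mem_range, Nat.lt_succ_iff]
    tauto
  · simp only [mem_singleton, h, false_or]
    constructor
    · exact fun h => ⟨h.le, h⟩
    · exact fun h => h.2

theorem mem_searchTrees {s : List ℕ} (hs : s.Pairwise (· ≤ ·)) {T : LabelledTree} :
    T ∈ searchTrees s ↔ T.IsSearch ∧ T.toList = s := by
  induction s generalizing T with
  | nil =>
    rw [searchTrees, mem_singleton]
    cases T <;> simp [IsSearch, toList]
  | cons x s ih =>
    rw [List.pairwise_cons] at hs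
    rw [searchTrees, mem_image]
    constructor
    · rintro ⟨⟨T, p⟩, h, rfl⟩
      obtain ⟨hT, hp, h⟩ := mem_sigma_searchTrees.1 h
      obtain ⟨hT', rfl⟩ := (ih hs.2).1 hT
      exact ⟨hT'.addFirst hs.1 hp h, toList_addFirst hp⟩
    · rintro ⟨hT, hl⟩
      obtain ⟨p, T', hp, hT', h, rfl⟩ := hT.exists_eq_addFirst hl
      rw [toList_addFirst hp, List.cons.injEq] at hl
      obtain ⟨-, rfl⟩ := hl
      exact ⟨⟨T', p⟩, mem_sigma_searchTrees.2 ⟨(ih hs.2).2 ⟨hT', rfl⟩, hp, h⟩, rfl⟩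

theorem sum_searchTrees_cons (x : ℕ) (s : List ℕ) (φ : ℕ → ℕ) :
    ∑ T ∈ searchTrees (x :: s), φ T.leftBranch = ∑ T ∈ searchTrees s,
      if ∀ z ∈ s, x < z then ∑ p ∈ range (T.leftBranch + 1), φ (p + 1)
      else φ (T.leftBranch + 1) := by
  rw [searchTrees, sum_image]
  · rw [← sum_sigma' (searchTrees s) (fun T => if ∀ z ∈ s, x < z then
      range (T.leftBranch + 1) else {T.leftBranch}) fun T p => φ (addFirst x p T).leftBranch]
    refine sum_congr rfl fun T _ => ?_
    split_ifs
    · refine sum_congr rfl fun p hp => ?_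
      rw [leftBranch_addFirst (Nat.lt_succ_iff.1 (mem_range.1 hp))]
    · rw [sum_singleton, leftBranch_addFirst le_rfl]
  · rintro ⟨T, p⟩ h ⟨T', p'⟩ h' e
    obtain ⟨-, hp, -⟩ := mem_sigma_searchTrees.1 h
    obtain ⟨-, hp', -⟩ := mem_sigma_searchTrees.1 h'
    dsimp only at e
    have hpp := congrArg leftBranch e
    rw [leftBranch_addFirst hp, leftBranch_addFirst hp', Nat.add_right_cancel_iff] at hpp
    subst hpp
    rw [addFirst_inj hp hp' e]

/-- The copy of `x` added first may take any place on the leftmost branch, which is the summation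
`true` followed by one shift. Every further copy is forced to the end of the branch and contributes
one more shift. -/
theorem sum_searchTrees_replicate_append (m x : ℕ) {s : List ℕ} (hs : ∀ z ∈ s, x < z)
    (w : List Bool) :
    ∑ T ∈ searchTrees (List.replicate (m + 1) x ++ s), pathCount w T.leftBranch =
      ∑ T ∈ searchTrees s,
        pathCount (true :: (List.replicate (m + 1) false ++ w)) T.leftBranch := by
  induction m generalizing w with
  | zero =>
    rw [zero_add, List.replicate_one, List.singleton_append, sum_searchTrees_cons]
    refine sum_congr rfl fun T _ => ?_
    rw [if_pos hs]
    rfl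
  | succ m ih =>
    rw [List.replicate_succ, List.cons_append, sum_searchTrees_cons]
    have h : ¬ ∀ z ∈ List.replicate (m + 1) x ++ s, x < z :=
      fun h => lt_irrefl x (h x (by simp))
    simp only [if_neg h]
    refine (ih (false :: w)).trans (sum_congr rfl fun T _ => ?_)
    rw [List.replicate_succ' (n := m + 1)]
    simp

end LabelledTree

/-! ### Sylvester classes of given evaluation -/

open LabelledTree

/-- The nondecreasing word of evaluation `c` over the letters greater than `k`. -/
def sortedWord : ℕ → List ℕ → List ℕ
  | _, [] => []
  | k, m :: c => List.replicate m (k + 1) ++ sortedWord (k + 1) c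

theorem lt_of_mem_sortedWord {k : ℕ} {c : List ℕ} {x : ℕ} (hx : x ∈ sortedWord k c) : k < x := by
  induction c generalizing k with
  | nil => simp [sortedWord] at hx
  | cons m c ih =>
    rcases List.mem_append.1 hx with hx | hx
    · rw [List.eq_of_mem_replicate hx]
      exact Nat.lt_succ_self k
    · exact (Nat.lt_succ_self k).trans (ih hx)

theorem pairwise_sortedWord (k : ℕ) (c : List ℕ) : (sortedWord k c).Pairwise (· ≤ ·) := by
  induction c generalizing k with
  | nil => exact List.Pairwise.nil
  | cons m c ih =>
    refine List.pairwise_append.2 ⟨List.pairwise_replicate.2 (by simp), ih _, ?_⟩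
    intro x hx y hy
    rw [List.eq_of_mem_replicate hx]
    exact (lt_of_mem_sortedWord hy).le

theorem count_sortedWord (k : ℕ) (c : List ℕ) (i : ℕ) :
    (sortedWord k c).count (k + i + 1) = c.getD i 0 := by
  induction c generalizing k i with
  | nil => simp [sortedWord]
  | cons m c ih =>
    rw [sortedWord, List.count_append]
    cases i with
    | zero =>
      have : k + 1 ∉ sortedWord (k + 1) c := fun h => lt_irrefl _ (lt_of_mem_sortedWord h)
      simp [List.count_eq_zero_of_not_mem this]
    | succ i =>
      rw [show k + (i + 1) + 1 = k + 1 + i + 1 by omega, ih]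
      simp [List.count_replicate]
      omega

theorem mem_wordsOfEvaluation_iff_perm {c w : List ℕ} :
    w ∈ wordsOfEvaluation c ↔ w.Perm (sortedWord 0 c) := by
  have hc : ∀ i, (sortedWord 0 c).count (i + 1) = c.getD i 0 := fun i => by
    simpa using count_sortedWord 0 c i
  constructor
  · rintro ⟨h1, h2⟩
    rw [List.perm_iff_count]
    intro x
    cases x with
    | zero =>
      rw [List.count_eq_zero_of_not_mem fun h => absurd (h1 0 h) (by simp),
        List.count_eq_zero_of_not_mem fun h => absurd (lt_of_mem_sortedWord h) (by simp)]
    | succ x => rw [h2, hc]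
  · intro h
    exact ⟨fun x hx => lt_of_mem_sortedWord (h.mem_iff.1 hx), fun i => by rw [h.count_eq, hc]⟩

/-- Nodes are added from the largest letter to the smallest, starting from a leaf with empty
leftmost branch. The block of the largest letter thus supplies the outermost operator, which is why
`c` is reversed. -/
theorem sum_searchTrees_sortedWord {c : List ℕ} (hc : ∀ m ∈ c, 0 < m) (k : ℕ) (w : List Bool) :
    ∑ T ∈ searchTrees (sortedWord k c), pathCount w T.leftBranch =
      pathCount (c.reverse.flatMap (fun l => true :: List.replicate l false) ++ w) 0 := by
  induction c generalizing k w with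
  | nil => simp [sortedWord, searchTrees, leftBranch]
  | cons m c ih =>
    obtain ⟨m, rfl⟩ := Nat.exists_eq_add_of_lt (hc m (by simp))
    rw [zero_add, sortedWord, sum_searchTrees_replicate_append _ _ fun z => lt_of_mem_sortedWord,
      ih fun m hm => hc m (by simp [hm])]
    simp

/-- Insertion is constant on classes, and a class is recovered from its tree through the postfix
reading, so classes of evaluation `c` biject with the search trees whose infix reading is the sorted
word. The trees are then counted with the empty boundary word, which gives each of them weight `1`.
-/
theorem encard_sylvesterClasses {c : List ℕ} (hc : ∀ m ∈ c, 0 < m) :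
    (sylvesterClasses c).encard = forestCount 1 (c.reverse.map (· + 1)) := by
  set f : Quot SylvesterStep → LabelledTree :=
    Quot.lift ofWord fun _ _ => ofWord_eq_of_sylvesterStep with hf
  have hinj : Function.Injective f := by
    rintro ⟨w⟩ ⟨w'⟩ h
    rw [quot_postfixReading_ofWord w, quot_postfixReading_ofWord w']
    exact congrArg (fun T => Quot.mk _ (postfixReading T)) h
  have himage : f '' sylvesterClasses c = searchTrees (sortedWord 0 c) := by
    ext T
    rw [sylvesterClasses, Set.image_image, mem_coe, mem_searchTrees (pairwise_sortedWord 0 c)]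
    constructor
    · rintro ⟨w, hw, rfl⟩
      rw [mem_wordsOfEvaluation_iff_perm] at hw
      have hT := isSearch_ofWord w
      exact ⟨hT, List.Perm.eq_of_pairwise' hT.pairwise_toList (pairwise_sortedWord 0 c)
        ((toList_ofWord_perm w).trans hw)⟩
    · rintro ⟨hT, hl⟩
      refine ⟨T.postfixReading, mem_wordsOfEvaluation_iff_perm.2 ?_, ofWord_postfixReading hT⟩
      rw [← hl]
      exact postfixReading_perm T
  rw [← hinj.encard_image, himage, Set.encard_coe_eq_coe_finsetCard, forestCount_succ_map_succ,
    card_eq_sum_ones]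
  have h := sum_searchTrees_sortedWord hc 0 []
  rw [List.append_nil] at h
  rw [← h]
  rfl

end NCLagrange

/-! ### The theorem -/

theorem mainTheorem3 (K : Type*) [CommRing K] (n : ℕ) :
    (∃! a : Composition n → K,
      negAlphabet K (g K n) = ∑ I : Composition n, ((-1) ^ I.length * a I) • gProd K I) ∧
    ∀ a : Composition n → K,
      negAlphabet K (g K n) = ∑ I : Composition n, ((-1) ^ I.length * a I) • gProd K I →
      ∀ I : Composition n,
        a I = ∑ J ∈ coarsenings (double I), pairing K (M K J) (g K (2 * n)) ∧
        a I = pairing K (E K (double I)) (g K (2 * n)) ∧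
        a I = ((ndpfOfType (I.blocks.map fun i => 2 * i + 1)).ncard : K) ∧
        (planeTreesOfType (I.blocks.map fun i => 2 * i + 1)).ncard =
          (ndpfOfType (I.blocks.map fun i => 2 * i + 1)).ncard ∧
        (sylvesterClasses (double I.reverse).blocks).ncard =
          (ndpfOfType (I.blocks.map fun i => 2 * i + 1)).ncard ∧
        (parkingQuasiRibbons (conjugate (double I))).ncard =
          (ndpfOfType (I.blocks.map fun i => 2 * i + 1)).ncard := by
  have huniq : ∀ a : Composition n → K,
      negAlphabet K (g K n) = ∑ I : Composition n, ((-1) ^ I.length * a I) • gProd K I →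
      a = fun I => (forestCount 1 (I.blocks.map fun i => 2 * i + 1) : K) := by
    intro a ha
    have h := gProd_coeff_unique K (ha.symm.trans (negAlphabet_g_eq_sum K n))
    funext I
    -- The sign is its own inverse, so it cancels over any commutative ring.
    have hI := congrArg ((-1) ^ I.length * ·) (congrFun h I)
    simpa only [← mul_assoc, ← pow_add, Even.neg_one_pow ⟨_, rfl⟩, one_mul] using hI
  refine ⟨⟨_, negAlphabet_g_eq_sum K n, huniq⟩, fun a ha I => ?_⟩
  have hodd : ∀ k ∈ I.blocks.map fun i => 2 * i + 1, 0 < k := by simp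
  have hdouble : (double I).blocks.map (· + 1) = I.blocks.map fun i => 2 * i + 1 := by
    simp [double]
  have hrev : (double I.reverse).blocks.reverse = (double I).blocks := by
    simp [double, Composition.reverse]
  have hndpf : (ndpfOfType (I.blocks.map fun i => 2 * i + 1)).ncard =
      forestCount 1 (I.blocks.map fun i => 2 * i + 1) := by
    rw [Set.ncard_def, encard_ndpfOfType hodd, ENat.toNat_natCast]
  have haI : a I = (forestCount 1 (I.blocks.map fun i => 2 * i + 1) : K) :=
    congrFun (huniq a ha) I
  have hsum : a I = ∑ J ∈ coarsenings (double I), pairing K (M K J) (g K (2 * n)) := by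
    rw [haI, ← hdouble, ← sum_coarsenings_forestCount, Nat.cast_sum]
    exact Finset.sum_congr rfl fun J _ => (pairing_M_g K J).symm
  rw [hndpf]
  refine ⟨hsum, ?_, haI, ?_, ?_, ?_⟩
  · rw [hsum, E, map_sum, LinearMap.sum_apply]
  · rw [Set.ncard_def, encard_planeTreesOfType hodd, ENat.toNat_natCast]
  -- The reversal in the evaluation undoes the reversal in the tree count.
  · rw [Set.ncard_def, encard_sylvesterClasses fun m hm => Composition.blocks_pos _ hm, hrev,
      hdouble, ENat.toNat_natCast]
  · rw [Set.ncard_def, encard_parkingQuasiRibbons, pathCount_conjugate, hdouble, ENat.toNat_natCast]
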